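/- For $x\in\mathbb{R}^3$ let $\langle x\rangle=(1+|x|^2)^{1/2}$, and for $s\in\mathbb{R}$ let $L^{2,s}=\langle x\rangle^{-s}L^2(\mathbb{R}^3,\mathbb{C}^4)$. Let $H=\alpha\cdot D+Q(x)$, where $\alpha\cdot D=\sum_{j=1}^3\alpha_j(-i\partial_{x_j})$ with the Dirac matrices $\alpha_j=\begin{pmatrix}0&\sigma_j\\ \sigma_j&0\end{pmatrix}$ built from the Pauli matrices $\sigma_1=\begin{pmatrix}0&1\\1&0\end{pmatrix}$, $\sigma_2=\begin{pmatrix}0&-i\\i&0\end{pmatrix}$, $\sigma_3=\begin{pmatrix}1&0\\0&-1\end{pmatrix}$, and where $Q$ is a measurable function on $\mathbb{R}^3$ with values in the Hermitian $4\times4$ matrices such that, for some $C>0$ and $\rho>1$, $|q_{jk}(x)|\le C\langle x\rangle^{-\rho}$ for all $x\in\mathbb{R}^3$ and $j,k=1,\dots,4$. If $f\in L^{2,-3/2}$ satisfies $Hf=0$ in the sense of distributions on $\mathbb{R}^3$, then $\langle x\rangle^{\mu}f\in H^1(\mathbb{R}^3,\mathbb{C}^4)$ for every real $\mu<1/2$.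 In particular, every such $f$ is a zero mode of $H$, that is, $f\in L^2(\mathbb{R}^3,\mathbb{C}^4)$, $f$ lies in the domain $H^1(\mathbb{R}^3,\mathbb{C}^4)$ of the self-adjoint operator $H$, and $Hf=0$; and $H$ has no zero resonance, that is, there is no $f\in L^{2,-3/2}\setminus L^2$ with $Hf=0$ in the sense of distributions. -/

import Mathlib

open MeasureTheory
open scoped ContDiff SchwartzMap

noncomputable section

/-- Euclidean space `ℝ³` (with the Euclidean norm and Lebesgue measure). -/
abbrev R3 : Type := EuclideanSpace ℝ (Fin 3)

/-- The space `ℂ⁴` of spinors, with its Hermitian norm. -/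
abbrev Spinor : Type := EuclideanSpace ℂ (Fin 4)

/-- The Japanese bracket `⟨x⟩ = (1 + |x|²)^(1/2)`. -/
def japaneseBracket (x : R3) : ℝ := Real.sqrt (1 + ‖x‖ ^ 2)

/-- The Pauli matrices `σ₁, σ₂, σ₃`, indexed by `0, 1, 2`. -/
def pauli : Fin 3 → Matrix (Fin 2) (Fin 2) ℂ :=
  ![!![0, 1; 1, 0], !![0, -Complex.I; Complex.I, 0], !![1, 0; 0, -1]]

/-- The Dirac matrices `αⱼ`, with blocks `0, σⱼ` in the first row and `σⱼ, 0` in the second. -/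
def diracAlpha (j : Fin 3) : Matrix (Fin 4) (Fin 4) ℂ :=
  Matrix.reindex finSumFinEquiv finSumFinEquiv (Matrix.fromBlocks 0 (pauli j) (pauli j) 0)

/-- The action of a `4 × 4` matrix on a spinor. -/
def matAct (A : Matrix (Fin 4) (Fin 4) ℂ) (v : Spinor) : Spinor :=
  WithLp.toLp 2 (A.mulVec v.ofLp)

/-- The function `⟨x⟩ˢ f`. -/
def weighted (s : ℝ) (f : R3 → Spinor) (x : R3) : Spinor :=
  (japaneseBracket x ^ s) • f x

/-- `f` belongs to the weighted space `L^{2,s}(ℝ³, ℂ⁴) = ⟨x⟩⁻ˢ L²(ℝ³, ℂ⁴)`. -/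
def MemWeightedL2 (s : ℝ) (f : R3 → Spinor) : Prop :=
  MemLp (weighted s f) 2 volume

/-- `f` belongs to the Sobolev space `H¹(ℝ³, ℂ⁴)`: it is square integrable, and the tempered
distribution it defines lies in the (Fourier-analytic) Sobolev space of order `1`. -/
def MemH1 (f : R3 → Spinor) : Prop :=
  ∃ hf : MemLp f 2 volume,
    TemperedDistribution.MemSobolev 1 2 ((hf.toLp f : Lp Spinor 2 (volume : Measure R3)) :
      𝓢'(R3, Spinor))

/-- The value at the scalar test function `φ` of the `ℂ⁴`-valued distribution
`H f = ∑ⱼ αⱼ (-i ∂ⱼ f) + Q f`, where `⟨-i ∂ⱼ f, φ⟩ = i ∫ (∂ⱼ φ) f`. -/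
def diracPairing (Q : R3 → Matrix (Fin 4) (Fin 4) ℂ) (f : R3 → Spinor) (φ : R3 → ℂ) : Spinor :=
  ∫ x, ((∑ j : Fin 3, (Complex.I * fderiv ℝ φ x (EuclideanSpace.single j 1)) •
    matAct (diracAlpha j) (f x)) + φ x • matAct (Q x) (f x))

/-- `H f = 0` in the sense of distributions. It is applied only to `f` in a weighted `L²` space
and locally bounded measurable `Q`, where the integrals converge absolutely. -/
def SolvesDirac (Q : R3 → Matrix (Fin 4) (Fin 4) ℂ) (f : R3 → Spinor) : Prop :=
  ∀ φ : R3 → ℂ, ContDiff ℝ ∞ φ → HasCompactSupport φ → diracPairing Q f φ = 0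

/-- `f` is a zero mode of `H`: a square integrable function in the domain `H¹` of the self-adjoint
operator `H` with `H f = 0`. -/
def IsZeroMode (Q : R3 → Matrix (Fin 4) (Fin 4) ℂ) (f : R3 → Spinor) : Prop :=
  MemLp f 2 volume ∧ MemH1 f ∧ SolvesDirac Q f

/-- `f` is a zero resonance state of `H`. -/
def IsZeroResonanceState (Q : R3 → Matrix (Fin 4) (Fin 4) ℂ) (f : R3 → Spinor) : Prop :=
  MemWeightedL2 (-3 / 2) f ∧ SolvesDirac Q f ∧ ¬ MemLp f 2 volume

/-- Zero is a resonance of `H`. -/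
def HasZeroResonance (Q : R3 → Matrix (Fin 4) (Fin 4) ℂ) : Prop :=
  ∃ f : R3 → Spinor, IsZeroResonanceState Q f

end

noncomputable section

open Filter Topology

/-! ### The Japanese bracket -/

/-! Write `g = Q f`, so that `α·D f = -g` weakly. The Dirac operator squares to `-Δ`, so formally
`f` is the convolution of `g` with a kernel of size `|x - y|⁻²`. The proof turns this into the
pointwise bound `|f| ≤ c ∫ |x - y|⁻² |g(y)| dy`, without first establishing the representation
formula.

For the bound, the weak equation is tested with a curl-free real field `b`, component by component;
`αₖ` is applied to the `k`-th identity and the results are summed. By the anticommutation relations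
the symmetric matrix `∂ⱼ bₖ` contracts to `div b`, so `i ∫ (div b) f + ∑ₖ ∫ bₖ αₖ g = 0`. The fields
do not have compact support, and the cutoff error is a Cauchy–Schwarz pairing over an annulus
between a factor bounded in `L²` and a tail of `⟨x⟩^(-3/2) f`. It tends to zero, and this is where
the exponent `-3/2` is critical (`IsWeakDirac.integral_eq`). Taking for `b` the rescaled field `z
⟨z⟩⁻³` centred at `x`, a smooth version of `z / |z|³`, makes `div b` an approximate identity while
`|b| ≤ |x - y|⁻²` uniformly in the scale. Letting the scale tend to zero yields the bound.

Schur's test shows that this Riesz potential maps `L^{2,s}` to `L^{2,s-1}` for `-1/2 < s < 3/2`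
(`exists_lintegral_rieszPotential_le`). Multiplication by `Q` gains `ρ` powers of decay and the
potential costs one, so each round improves the decay of `f` by `ρ - 1 > 0`. Finitely many rounds
reach every exponent below `1/2` (`SolvesDirac.memWeightedL2`).

For regularity, `⟨x⟩^μ f` again solves a weak Dirac equation with square integrable source, the
commutator with the weight being harmless. Hence its Laplacian is a sum of first derivatives of `L²`
functions, which puts it in `H¹` (`IsWeakDirac.memH1`). The case `μ = 0` gives zero modes and
excludes resonances. -/

theorem japaneseBracket_pos (x : R3) : 0 < japaneseBracket x :=
  Real.sqrt_pos.2 (by positivity)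

theorem one_le_japaneseBracket (x : R3) : 1 ≤ japaneseBracket x :=
  Real.one_le_sqrt.2 (by nlinarith [sq_nonneg ‖x‖])

theorem sq_japaneseBracket (x : R3) : japaneseBracket x ^ 2 = 1 + ‖x‖ ^ 2 :=
  Real.sq_sqrt (by positivity)

theorem norm_le_japaneseBracket (x : R3) : ‖x‖ ≤ japaneseBracket x :=
  Real.le_sqrt_of_sq_le (by linarith)

theorem japaneseBracket_le_one_add_norm (x : R3) : japaneseBracket x ≤ 1 + ‖x‖ :=
  Real.sqrt_le_iff.2 ⟨by positivity, by nlinarith [norm_nonneg x]⟩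

theorem japaneseBracket_le_add (x y : R3) :
    japaneseBracket x ≤ japaneseBracket y + ‖x - y‖ := by
  refine Real.sqrt_le_iff.2 ⟨add_nonneg (japaneseBracket_pos y).le (norm_nonneg _), ?_⟩
  have h1 : ‖x‖ ≤ ‖y‖ + ‖x - y‖ := by simpa using norm_add_le y (x - y)
  have h2 := sq_japaneseBracket y
  have h3 := norm_le_japaneseBracket y
  nlinarith [norm_nonneg x, norm_nonneg y, norm_nonneg (x - y), mul_le_mul_of_nonneg_right h3
    (norm_nonneg (x - y))]

theorem japaneseBracket_rpow (x : R3) (s : ℝ) :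
    japaneseBracket x ^ s = (1 + ‖x‖ ^ 2) ^ (s / 2) := by
  rw [japaneseBracket, Real.sqrt_eq_rpow, ← Real.rpow_mul (by positivity)]
  ring_nf

theorem contDiff_japaneseBracket_rpow (s : ℝ) :
    ContDiff ℝ ∞ (fun x : R3 => japaneseBracket x ^ s) := by
  simp_rw [japaneseBracket_rpow]
  exact (contDiff_const.add (contDiff_norm_sq ℝ)).rpow_const_of_ne
    fun x => by positivity

theorem continuous_japaneseBracket_rpow (s : ℝ) :
    Continuous (fun x : R3 => japaneseBracket x ^ s) :=
  (contDiff_japaneseBracket_rpow s).continuous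

theorem japaneseBracket_rpow_pos (x : R3) (s : ℝ) : 0 < japaneseBracket x ^ s :=
  Real.rpow_pos_of_pos (japaneseBracket_pos x) s

theorem japaneseBracket_rpow_mono (x : R3) {s t : ℝ} (h : s ≤ t) :
    japaneseBracket x ^ s ≤ japaneseBracket x ^ t :=
  Real.rpow_le_rpow_of_exponent_le (one_le_japaneseBracket x) h

theorem hasFDerivAt_one_add_norm_sq_rpow (s : ℝ) (x : R3) :
    HasFDerivAt (fun x : R3 => (1 + ‖x‖ ^ 2) ^ s)
      ((2 * s * (1 + ‖x‖ ^ 2) ^ (s - 1)) • innerSL ℝ x) x := by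
  have h1 : HasFDerivAt (fun x : R3 => 1 + ‖x‖ ^ 2) ((2 : ℝ) • innerSL ℝ x) x := by
    have h := (hasStrictFDerivAt_norm_sq x).hasFDerivAt.const_add 1
    exact h.congr_fderiv (by ext v; simp)
  refine (h1.rpow_const (p := s) (Or.inl (by positivity))).congr_fderiv ?_
  ext v
  simp
  ring

theorem norm_fderiv_japaneseBracket_rpow_le (s : ℝ) (x : R3) :
    ‖fderiv ℝ (fun x : R3 => japaneseBracket x ^ s) x‖ ≤ |s| * japaneseBracket x ^ (s - 1) := by
  have h : fderiv ℝ (fun x : R3 => japaneseBracket x ^ s) x =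
      (2 * (s / 2) * (1 + ‖x‖ ^ 2) ^ (s / 2 - 1)) • innerSL ℝ x := by
    simp_rw [japaneseBracket_rpow]
    exact (hasFDerivAt_one_add_norm_sq_rpow (s / 2) x).fderiv
  have h2 : (1 + ‖x‖ ^ 2) ^ (s / 2 - 1) * japaneseBracket x = japaneseBracket x ^ (s - 1) := by
    rw [show s / 2 - 1 = (s - 2) / 2 by ring, ← japaneseBracket_rpow]
    nth_rewrite 2 [← Real.rpow_one (japaneseBracket x)]
    rw [← Real.rpow_add (japaneseBracket_pos x)]
    ring_nf
  rw [h, norm_smul, innerSL_apply_norm, ← h2, Real.norm_eq_abs, abs_mul,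
    show 2 * (s / 2) = s by ring, abs_of_pos (a := (1 + ‖x‖ ^ 2) ^ (s / 2 - 1)) (by positivity),
    mul_assoc]
  gcongr
  exact norm_le_japaneseBracket x

/-! ### Matrices acting on spinors -/

/-- The action of a matrix on spinors as a continuous linear map. -/
def matCLM (A : Matrix (Fin 4) (Fin 4) ℂ) : Spinor →L[ℂ] Spinor :=
  LinearMap.toContinuousLinearMap (Matrix.toEuclideanLin A)

theorem matCLM_apply (A : Matrix (Fin 4) (Fin 4) ℂ) (v : Spinor) : matCLM A v = matAct A v := rfl

theorem matAct_matAct (A B : Matrix (Fin 4) (Fin 4) ℂ) (v : Spinor) :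
    matAct A (matAct B v) = matAct (A * B) v := by
  simp [matAct, Matrix.mulVec_mulVec]

theorem norm_matAct_le {A : Matrix (Fin 4) (Fin 4) ℂ} {c : ℝ} (hc : 0 ≤ c)
    (hA : ∀ j k, ‖A j k‖ ≤ c) (v : Spinor) : ‖matAct A v‖ ≤ 8 * c * ‖v‖ := by
  -- Four entries per row give the factor 4; the Euclidean norm over four components gives a further
  -- 2. The constant is not sharp.
  have h1 : ∀ j, ‖matAct A v j‖ ≤ 4 * c * ‖v‖ := fun j => by
    calc ‖matAct A v j‖ = ‖∑ k, A j k * v k‖ := rfl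
      _ ≤ ∑ k, ‖A j k * v k‖ := norm_sum_le _ _
      _ ≤ ∑ _k : Fin 4, c * ‖v‖ := Finset.sum_le_sum fun k _ => by
        rw [norm_mul]
        exact mul_le_mul (hA j k) (PiLp.norm_apply_le v k) (norm_nonneg _) hc
      _ = 4 * c * ‖v‖ := by simp; ring
  rw [EuclideanSpace.norm_eq]
  refine Real.sqrt_le_iff.2 ⟨by positivity, ?_⟩
  calc ∑ j, ‖matAct A v j‖ ^ 2 ≤ ∑ _j : Fin 4, (4 * c * ‖v‖) ^ 2 :=
        Finset.sum_le_sum fun j _ => pow_le_pow_left₀ (norm_nonneg _) (h1 j) 2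
    _ = (8 * c * ‖v‖) ^ 2 := by simp; ring

theorem pauli_anticomm (j k : Fin 3) :
    pauli j * pauli k + pauli k * pauli j = if j = k then (2 : ℂ) • 1 else 0 := by
  fin_cases j <;> fin_cases k <;> ext a b <;> fin_cases a <;> fin_cases b <;>
    simp [pauli] <;> norm_num

theorem diracAlpha_anticomm (j k : Fin 3) :
    diracAlpha j * diracAlpha k + diracAlpha k * diracAlpha j = if j = k then (2 : ℂ) • 1 else 0 := by
  have h := pauli_anticomm j k
  simp only [diracAlpha, Matrix.reindex_apply, Matrix.submatrix_mul_equiv,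
    Matrix.fromBlocks_multiply]
  have hadd : ∀ (A B : Matrix (Fin 2 ⊕ Fin 2) (Fin 2 ⊕ Fin 2) ℂ) (e : Fin 4 → Fin 2 ⊕ Fin 2),
      A.submatrix e e + B.submatrix e e = (A + B).submatrix e e := fun _ _ _ => rfl
  rw [hadd, Matrix.fromBlocks_add]
  simp only [zero_mul, mul_zero, zero_add, add_zero, h]
  split_ifs with hjk
  · rw [show Matrix.fromBlocks ((2 : ℂ) • (1 : Matrix (Fin 2) (Fin 2) ℂ)) 0 0 ((2 : ℂ) • 1) =
      (2 : ℂ) • 1 by rw [← Matrix.fromBlocks_one, Matrix.fromBlocks_smul]; simp]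
    rw [Matrix.submatrix_smul]
    simp
  · simp

theorem diracAlpha_anticomm_apply (j k : Fin 3) (v : Spinor) :
    matAct (diracAlpha j) (matAct (diracAlpha k) v) +
      matAct (diracAlpha k) (matAct (diracAlpha j) v) = if j = k then (2 : ℂ) • v else 0 := by
  rw [matAct_matAct, matAct_matAct, ← matCLM_apply, ← matCLM_apply]
  have : matCLM (diracAlpha j * diracAlpha k) v + matCLM (diracAlpha k * diracAlpha j) v =
      matCLM (diracAlpha j * diracAlpha k + diracAlpha k * diracAlpha j) v := by
    simp [matCLM]
  rw [this, diracAlpha_anticomm]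
  split_ifs
  · ext i
    simp [matCLM_apply, matAct, Matrix.smul_mulVec]
  · simp [matCLM]

/-- A symmetric matrix of coefficients contracts with products of Dirac matrices to its trace. -/
theorem sum_smul_diracAlpha_diracAlpha (a : Fin 3 → Fin 3 → ℂ) (ha : ∀ j k, a j k = a k j)
    (v : Spinor) :
    ∑ j, ∑ k, a j k • matAct (diracAlpha j) (matAct (diracAlpha k) v) = (∑ j, a j j) • v := by
  -- Add the sum to its copy with the two indices exchanged, so that anticommutators appear, and
  -- cancel the factor 2.
  have h2 : (2 : ℂ) • ∑ j, ∑ k, a j k • matAct (diracAlpha j) (matAct (diracAlpha k) v) =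
      (2 : ℂ) • (∑ j, a j j) • v := by
    calc (2 : ℂ) • ∑ j, ∑ k, a j k • matAct (diracAlpha j) (matAct (diracAlpha k) v)
      _ = ∑ j, ∑ k, a j k • matAct (diracAlpha j) (matAct (diracAlpha k) v) +
          ∑ j, ∑ k, a k j • matAct (diracAlpha k) (matAct (diracAlpha j) v) := by
        rw [two_smul]
        congr 1
        exact Finset.sum_comm
      _ = ∑ j, ∑ k, a j k • (if j = k then (2 : ℂ) • v else 0) := by
        rw [← Finset.sum_add_distrib]
        refine Finset.sum_congr rfl fun j _ => ?_
        rw [← Finset.sum_add_distrib]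
        refine Finset.sum_congr rfl fun k _ => ?_
        rw [← diracAlpha_anticomm_apply, smul_add, ha k j]
      _ = (2 : ℂ) • (∑ j, a j j) • v := by
        simp [Finset.sum_smul, Finset.smul_sum, smul_smul, mul_comm]
  exact smul_right_injective Spinor (two_ne_zero) h2

/-! ### Weighted spaces -/

theorem weighted_zero (f : R3 → Spinor) : weighted 0 f = f := by
  ext x
  simp [weighted]

theorem enorm_weighted_rpow_two (s : ℝ) (f : R3 → Spinor) (x : R3) :
    ‖weighted s f x‖ₑ ^ (2 : ℝ) = ENNReal.ofReal (japaneseBracket x ^ (2 * s)) * ‖f x‖ₑ ^ 2 := by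
  have h := japaneseBracket_rpow_pos x s
  rw [weighted, enorm_smul, Real.enorm_eq_ofReal h.le, ENNReal.rpow_two, mul_pow,
    ← ENNReal.ofReal_pow h.le, ← Real.rpow_natCast, ← Real.rpow_mul (japaneseBracket_pos x).le]
  push_cast
  rw [mul_comm s 2]

theorem MemWeightedL2.aestronglyMeasurable {s : ℝ} {f : R3 → Spinor} (hf : MemWeightedL2 s f) :
    AEStronglyMeasurable f volume := by
  have h := (continuous_japaneseBracket_rpow (-s)).aestronglyMeasurable.smul
    (MemLp.aestronglyMeasurable hf) (μ := volume)
  refine h.congr (.of_forall fun x => ?_)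
  change japaneseBracket x ^ (-s) • japaneseBracket x ^ s • f x = f x
  rw [smul_smul, ← Real.rpow_add (japaneseBracket_pos x), neg_add_cancel, Real.rpow_zero, one_smul]

theorem memWeightedL2_iff {s : ℝ} {f : R3 → Spinor} (hf : AEStronglyMeasurable f volume) :
    MemWeightedL2 s f ↔
      ∫⁻ x, ENNReal.ofReal (japaneseBracket x ^ (2 * s)) * ‖f x‖ₑ ^ 2 < ⊤ := by
  have hm : AEStronglyMeasurable (weighted s f) volume :=
    (continuous_japaneseBracket_rpow s).aestronglyMeasurable.smul hf
  rw [MemWeightedL2, MemLp, eLpNorm_lt_top_iff_lintegral_rpow_enorm_lt_top (by simp) (by simp)]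
  simp only [hm, true_and, ENNReal.toReal_ofNat, enorm_weighted_rpow_two]

theorem MemWeightedL2.of_le {s t c : ℝ} {f g : R3 → Spinor} (hf : MemWeightedL2 s f)
    (hg : AEStronglyMeasurable g volume)
    (h : ∀ x, ‖g x‖ ≤ c * japaneseBracket x ^ (s - t) * ‖f x‖) : MemWeightedL2 t g := by
  refine MemLp.of_le_mul (c := c) hf
    ((continuous_japaneseBracket_rpow t).aestronglyMeasurable.smul hg) (.of_forall fun x => ?_)
  rw [weighted, weighted, norm_smul, norm_smul, Real.norm_of_nonneg (japaneseBracket_rpow_pos _ _).le,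
    Real.norm_of_nonneg (japaneseBracket_rpow_pos _ _).le]
  calc japaneseBracket x ^ t * ‖g x‖
      ≤ japaneseBracket x ^ t * (c * japaneseBracket x ^ (s - t) * ‖f x‖) :=
        mul_le_mul_of_nonneg_left (h x) (japaneseBracket_rpow_pos x t).le
    _ = c * ((japaneseBracket x ^ t * japaneseBracket x ^ (s - t)) * ‖f x‖) := by ring
    _ = c * (japaneseBracket x ^ s * ‖f x‖) := by
      rw [← Real.rpow_add (japaneseBracket_pos x)]
      ring_nf

theorem MemWeightedL2.mono {s t : ℝ} {f : R3 → Spinor} (hf : MemWeightedL2 s f) (h : t ≤ s) :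
    MemWeightedL2 t f := by
  refine hf.of_le (c := 1) hf.aestronglyMeasurable fun x => ?_
  rw [one_mul]
  exact le_mul_of_one_le_left (norm_nonneg _)
    (Real.one_le_rpow (one_le_japaneseBracket x) (by linarith))

/-! ### Weighted bounds for the Riesz potential of order one -/

theorem lintegral_comp_inv_smul {r : ℝ} (hr : 0 < r) (g : R3 → ENNReal) :
    ∫⁻ x, g (r⁻¹ • x) = ENNReal.ofReal (r ^ 3) * ∫⁻ x, g x := by
  have he : MeasurableEmbedding (fun x : R3 => r⁻¹ • x) :=
    (Homeomorph.smulOfNeZero r⁻¹ (inv_ne_zero hr.ne')).measurableEmbedding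
  rw [← he.lintegral_map g, Measure.map_addHaar_smul volume (inv_ne_zero hr.ne'),
    lintegral_smul_measure]
  simp [abs_of_pos hr]

theorem lintegral_ofReal_norm_div {r : ℝ} (hr : 0 < r) (F : ℝ → ℝ) :
    ∫⁻ x : R3, ENNReal.ofReal (F (‖x‖ / r)) =
      ENNReal.ofReal (r ^ 3) * ∫⁻ x : R3, ENNReal.ofReal (F ‖x‖) := by
  rw [← lintegral_comp_inv_smul hr]
  refine lintegral_congr fun x => ?_
  rw [norm_smul, norm_inv, Real.norm_of_nonneg hr.le, div_eq_inv_mul]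

theorem lintegral_ofReal_radial_lt_top {F : ℝ → ℝ}
    (hF : IntegrableOn (fun y : ℝ => y ^ 2 * F y) (Set.Ioi 0)) :
    ∫⁻ x : R3, ENNReal.ofReal (F ‖x‖) < ⊤ := by
  have h : Integrable (fun x : R3 => F ‖x‖) volume := by
    rw [integrable_fun_norm_addHaar]
    simpa using hF
  exact h.lintegral_lt_top

theorem lintegral_inv_sq_near_lt_top :
    ∫⁻ x : R3, ENNReal.ofReal (if ‖x‖ < 1 / 2 then (‖x‖ ^ 2)⁻¹ else 0) < ⊤ := by
  refine lintegral_ofReal_radial_lt_top (F := fun u => if u < 1 / 2 then (u ^ 2)⁻¹ else 0) ?_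
  have h : IntegrableOn ((Set.Ioo (0 : ℝ) (1 / 2)).indicator fun _ => (1 : ℝ)) (Set.Ioi 0) := by
    refine Integrable.integrableOn ?_
    rw [integrable_indicator_iff measurableSet_Ioo]
    simp
  refine h.congr_fun (fun y hy => ?_) measurableSet_Ioi
  have hy' : (0 : ℝ) < y := hy
  by_cases h2 : y < 1 / 2
  · simp only [Set.indicator, Set.mem_Ioo, hy', h2, and_self, if_true]
    field_simp
  · simp only [Set.indicator, Set.mem_Ioo, h2, and_false, if_false, mul_zero]

/-- In polar coordinates the integrand is of order `u^(2-t)` at the origin, which needs `t < 3`, and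
of order `u^(-t)` at infinity, which needs `1 < t`. -/
theorem lintegral_rpow_div_lt_top {t : ℝ} (ht1 : 1 < t) (ht3 : t < 3) :
    ∫⁻ x : R3, ENNReal.ofReal (‖x‖ ^ (-t) / (1 + ‖x‖ ^ 2)) < ⊤ := by
  refine lintegral_ofReal_radial_lt_top (F := fun u => u ^ (-t) / (1 + u ^ 2)) ?_
  have hmeas : Measurable fun y : ℝ => y ^ 2 * (y ^ (-t) / (1 + y ^ 2)) := by fun_prop
  rw [← Set.Ioc_union_Ioi_eq_Ioi zero_le_one]
  refine IntegrableOn.union ?_ ?_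
  · have h : IntegrableOn (fun y : ℝ => y ^ (2 - t)) (Set.Ioc 0 1) := by
      rw [← intervalIntegrable_iff_integrableOn_Ioc_of_le zero_le_one]
      exact intervalIntegral.intervalIntegrable_rpow' (by linarith)
    refine Integrable.mono' h hmeas.aestronglyMeasurable ?_
    refine (ae_restrict_iff' measurableSet_Ioc).2 (.of_forall fun y hy => ?_)
    have hy0 : 0 < y := hy.1
    rw [Real.norm_of_nonneg (by positivity), sub_eq_add_neg, Real.rpow_add hy0, Real.rpow_two]
    refine mul_le_mul_of_nonneg_left (div_le_self (by positivity) ?_) (by positivity)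
    nlinarith [sq_nonneg y]
  · have h : IntegrableOn (fun y : ℝ => y ^ (-t)) (Set.Ioi 1) :=
      integrableOn_Ioi_rpow_of_lt (by linarith) one_pos
    refine Integrable.mono' h hmeas.aestronglyMeasurable ?_
    refine (ae_restrict_iff' measurableSet_Ioi).2 (.of_forall fun y hy => ?_)
    have hy0 : 0 < y := zero_lt_one.trans hy
    rw [Real.norm_of_nonneg (by positivity), ← mul_div_assoc, mul_comm, mul_div_assoc]
    refine mul_le_of_le_one_right (by positivity) ?_
    rw [div_le_one (by positivity)]
    linarith

/-- Split at `|x - y| = ⟨x⟩/2`. In the near region `⟨y⟩` is at least `⟨x⟩/2`; in the far region `|x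
- y|` controls both `⟨x⟩` and `|y|`. Both majorants are functions of lengths divided by `⟨x⟩`, so
the integrals in `y` scale. The point `y = 0` is excluded because there the real power `‖y‖ ^ (-t)`
takes the default value 0. -/
theorem inv_sq_mul_japaneseBracket_rpow_le {t : ℝ} (ht : 0 < t) (x y : R3) (hy : y ≠ 0) :
    (‖x - y‖ ^ 2)⁻¹ * japaneseBracket y ^ (-t) ≤
      2 ^ t * japaneseBracket x ^ (-t - 2) *
        (if ‖x - y‖ / japaneseBracket x < 1 / 2 then ((‖x - y‖ / japaneseBracket x) ^ 2)⁻¹ else 0) +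
      13 * japaneseBracket x ^ (-t - 2) *
        ((‖y‖ / japaneseBracket x) ^ (-t) / (1 + (‖y‖ / japaneseBracket x) ^ 2)) := by
  have hr := japaneseBracket_pos x
  have hjy := japaneseBracket_pos y
  have hle := japaneseBracket_le_add x y
  set r := japaneseBracket x with hrdef
  have hn : 0 < ‖y‖ := norm_pos_iff.2 hy
  have hr2 : r ^ (-t - 2) = r ^ (-t) / r ^ 2 := by
    rw [Real.rpow_sub hr, Real.rpow_two]
  by_cases h : ‖x - y‖ / r < 1 / 2
  · have h1 : ‖x - y‖ < r / 2 := by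
      rw [div_lt_iff₀ hr] at h
      linarith
    have h2 : japaneseBracket y ^ (-t) ≤ 2 ^ t * r ^ (-t) := by
      have h3 : japaneseBracket y ^ (-t) ≤ (r / 2) ^ (-t) :=
        Real.rpow_le_rpow_of_nonpos (by positivity) (by linarith) (by linarith)
      rw [Real.div_rpow hr.le zero_le_two, Real.rpow_neg zero_le_two, div_inv_eq_mul] at h3
      linarith
    rw [if_pos h]
    refine le_add_of_le_of_nonneg ?_ (by positivity)
    calc (‖x - y‖ ^ 2)⁻¹ * japaneseBracket y ^ (-t)
        ≤ (‖x - y‖ ^ 2)⁻¹ * (2 ^ t * r ^ (-t)) := by gcongr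
      _ = 2 ^ t * r ^ (-t - 2) * ((‖x - y‖ / r) ^ 2)⁻¹ := by
        rw [hr2, div_pow, inv_div]
        field_simp
  · rw [if_neg h, mul_zero, zero_add]
    have h1 : r / 2 ≤ ‖x - y‖ := by
      rw [not_lt, le_div_iff₀ hr] at h
      linarith
    have h0 : 0 < ‖x - y‖ := lt_of_lt_of_le (by positivity) h1
    have h2 : ‖y‖ ≤ 3 * ‖x - y‖ := by
      have h3 : ‖y‖ ≤ ‖x‖ + ‖x - y‖ := by
        have := norm_sub_le x (x - y)
        simpa using this
      have h4 := norm_le_japaneseBracket x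
      linarith
    have h5 : japaneseBracket y ^ (-t) ≤ ‖y‖ ^ (-t) :=
      Real.rpow_le_rpow_of_nonpos hn (norm_le_japaneseBracket y) (by linarith)
    -- With `d = |x - y|`, the bounds `⟨x⟩ ≤ 2d` and `|y| ≤ 3d` give `⟨x⟩² + |y|² ≤ (4 + 9) d²`.
    have h6 : (‖x - y‖ ^ 2)⁻¹ ≤ 13 / (r ^ 2 + ‖y‖ ^ 2) := by
      rw [← one_div, div_le_div_iff₀ (by positivity) (by positivity)]
      nlinarith
    calc (‖x - y‖ ^ 2)⁻¹ * japaneseBracket y ^ (-t)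
        ≤ 13 / (r ^ 2 + ‖y‖ ^ 2) * ‖y‖ ^ (-t) := by gcongr
      _ = 13 * r ^ (-t - 2) * ((‖y‖ / r) ^ (-t) / (1 + (‖y‖ / r) ^ 2)) := by
        have hrt : 0 < r ^ (-t) := by positivity
        rw [hr2, Real.div_rpow hn.le hr.le]
        field_simp

/-- The kernel `|x - y|⁻²` of the Riesz potential of order one on `ℝ³`. -/
def rieszKernel (x y : R3) : ENNReal := ENNReal.ofReal ((‖x - y‖ ^ 2)⁻¹)

theorem rieszKernel_comm (x y : R3) : rieszKernel x y = rieszKernel y x := by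
  rw [rieszKernel, rieszKernel, norm_sub_rev]

theorem measurable_rieszKernel : Measurable (fun p : R3 × R3 => rieszKernel p.1 p.2) := by
  unfold rieszKernel
  fun_prop

/-- The weight `⟨x⟩ᵗ` with values in `[0, ∞]`. -/
def bracketWeight (t : ℝ) (x : R3) : ENNReal := ENNReal.ofReal (japaneseBracket x ^ t)

theorem measurable_bracketWeight (t : ℝ) : Measurable (bracketWeight t) :=
  (continuous_japaneseBracket_rpow t).measurable.ennreal_ofReal

theorem bracketWeight_mul (s t : ℝ) (x : R3) :
    bracketWeight s x * bracketWeight t x = bracketWeight (s + t) x := by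
  rw [bracketWeight, bracketWeight, bracketWeight, Real.rpow_add (japaneseBracket_pos x),
    ENNReal.ofReal_mul (japaneseBracket_rpow_pos x s).le]

theorem bracketWeight_zero (x : R3) : bracketWeight 0 x = 1 := by
  simp [bracketWeight]

theorem bracketWeight_ne_top (s : ℝ) (x : R3) : bracketWeight s x ≠ ⊤ := ENNReal.ofReal_ne_top

/-- Integrating the near/far majorant scales out `⟨x⟩`: the prefactor `⟨x⟩^(-t-2)` times the
Jacobian `⟨x⟩³` is `⟨x⟩^(1-t)`. -/
theorem exists_lintegral_rieszKernel_mul_le {t : ℝ} (ht1 : 1 < t) (ht3 : t < 3) :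
    ∃ C : ENNReal, C ≠ ⊤ ∧ ∀ x : R3,
      ∫⁻ y, rieszKernel x y * bracketWeight (-t) y ≤ C * bracketWeight (1 - t) x := by
  set c1 := ∫⁻ x : R3, ENNReal.ofReal (if ‖x‖ < 1 / 2 then (‖x‖ ^ 2)⁻¹ else 0) with hc1
  set c2 := ∫⁻ x : R3, ENNReal.ofReal (‖x‖ ^ (-t) / (1 + ‖x‖ ^ 2)) with hc2
  have h1 : c1 ≠ ⊤ := lintegral_inv_sq_near_lt_top.ne
  have h2 : c2 ≠ ⊤ := (lintegral_rpow_div_lt_top ht1 ht3).ne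
  refine ⟨ENNReal.ofReal (2 ^ t) * c1 + ENNReal.ofReal 13 * c2,
    by finiteness, fun x => ?_⟩
  have hr := japaneseBracket_pos x
  set r := japaneseBracket x with hrdef
  have hr3 : r ^ (-t - 2) * r ^ 3 = r ^ (1 - t) := by
    rw [← Real.rpow_natCast, ← Real.rpow_add hr]
    push_cast
    ring_nf
  have hm1 : Measurable fun y : R3 => ENNReal.ofReal (2 ^ t * r ^ (-t - 2) *
        (if ‖x - y‖ / r < 1 / 2 then ((‖x - y‖ / r) ^ 2)⁻¹ else 0)) := by
    refine Measurable.ennreal_ofReal (Measurable.const_mul (Measurable.ite ?_ ?_ ?_) _)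
    · exact measurableSet_lt (by fun_prop) (by fun_prop)
    · fun_prop
    · fun_prop
  calc ∫⁻ y, rieszKernel x y * bracketWeight (-t) y
      ≤ ∫⁻ y, (ENNReal.ofReal (2 ^ t * r ^ (-t - 2) *
        (if ‖x - y‖ / r < 1 / 2 then ((‖x - y‖ / r) ^ 2)⁻¹ else 0)) +
        ENNReal.ofReal (13 * r ^ (-t - 2) *
        ((‖y‖ / r) ^ (-t) / (1 + (‖y‖ / r) ^ 2)))) := by
        refine lintegral_mono_ae ?_
        filter_upwards [compl_mem_ae_iff.2 (measure_singleton (0 : R3))] with y hy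
        rw [rieszKernel, bracketWeight, ← ENNReal.ofReal_mul (by positivity),
          ← ENNReal.ofReal_add (by positivity) (by positivity)]
        exact ENNReal.ofReal_le_ofReal
          (inv_sq_mul_japaneseBracket_rpow_le (by linarith) x y hy)
    _ = ENNReal.ofReal (2 ^ t * r ^ (-t - 2)) * (ENNReal.ofReal (r ^ 3) * c1) +
        ENNReal.ofReal (13 * r ^ (-t - 2)) * (ENNReal.ofReal (r ^ 3) * c2) := by
        rw [lintegral_add_left hm1]
        congr 1
        · simp_rw [ENNReal.ofReal_mul (p := 2 ^ t * r ^ (-t - 2)) (by positivity)]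
          rw [lintegral_const_mul' _ _ ENNReal.ofReal_ne_top, hc1,
            ← lintegral_ofReal_norm_div hr (fun u => if u < 1 / 2 then (u ^ 2)⁻¹ else 0),
            ← lintegral_sub_left_eq_self _ x]
          simp only [sub_sub_cancel]
        · simp_rw [ENNReal.ofReal_mul (p := 13 * r ^ (-t - 2)) (by positivity)]
          rw [lintegral_const_mul' _ _ ENNReal.ofReal_ne_top, hc2,
            ← lintegral_ofReal_norm_div hr (fun u => u ^ (-t) / (1 + u ^ 2))]
    _ = (ENNReal.ofReal (2 ^ t) * c1 + ENNReal.ofReal 13 * c2) * bracketWeight (1 - t) x := by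
        rw [bracketWeight, ← hrdef, ← hr3, ENNReal.ofReal_mul (p := 2 ^ t) (by positivity),
          ENNReal.ofReal_mul (p := 13) (by positivity),
          ENNReal.ofReal_mul (p := r ^ (-t - 2)) (by positivity)]
        ring

/-- The Riesz potential `∫ |x - y|⁻² G(y) dy` of order one, up to a constant factor. -/
def rieszPotential (G : R3 → ENNReal) (x : R3) : ENNReal := ∫⁻ y, rieszKernel x y * G y

theorem measurable_rieszPotential {G : R3 → ENNReal} (hG : AEMeasurable G) :
    Measurable (rieszPotential G) := by
  have h : rieszPotential G = rieszPotential (hG.mk G) := by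
    ext x
    refine lintegral_congr_ae ?_
    filter_upwards [hG.ae_eq_mk] with y hy
    rw [hy]
  rw [h]
  exact Measurable.lintegral_prod_right'
    (f := fun p : R3 × R3 => rieszKernel p.1 p.2 * hG.mk G p.2)
    (measurable_rieszKernel.mul (hG.measurable_mk.comp measurable_snd))

/-! ### Schur's test for the Riesz potential -/

theorem sq_lintegral_mul_le {f g : R3 → ENNReal} (hf : AEMeasurable f) (hg : AEMeasurable g) :
    (∫⁻ x, f x * g x) ^ 2 ≤ (∫⁻ x, f x ^ 2) * ∫⁻ x, g x ^ 2 := by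
  have h := ENNReal.lintegral_mul_le_Lp_mul_Lq volume Real.HolderConjugate.two_two hf hg
  have h2 := pow_le_pow_left' h 2
  simp only [Pi.mul_apply] at h2
  refine h2.trans (le_of_eq ?_)
  rw [mul_pow, ← ENNReal.rpow_two, ← ENNReal.rpow_two, ← ENNReal.rpow_mul, ← ENNReal.rpow_mul]
  norm_num

theorem measurable_rieszKernel_left (x : R3) : Measurable (rieszKernel x) := by
  unfold rieszKernel
  fun_prop

/-- Cauchy–Schwarz after splitting the kernel into two square roots and inserting `⟨y⟩^(-a/2)
⟨y⟩^(a/2) = 1`; `a` is the free exponent of Schur's test. -/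
theorem sq_rieszPotential_le (a : ℝ) {G : R3 → ENNReal} (hG : AEMeasurable G) (x : R3) :
    rieszPotential G x ^ 2 ≤ (∫⁻ y, rieszKernel x y * bracketWeight (-a) y) *
      ∫⁻ y, rieszKernel x y * (bracketWeight a y * G y ^ 2) := by
  have hk := measurable_rieszKernel_left x
  calc rieszPotential G x ^ 2
      = (∫⁻ y, (rieszKernel x y ^ (1 / 2 : ℝ) * bracketWeight (-a / 2) y) *
        (rieszKernel x y ^ (1 / 2 : ℝ) * (bracketWeight (a / 2) y * G y))) ^ 2 := by
        congr 1
        refine lintegral_congr fun y => ?_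
        have e1 : rieszKernel x y ^ (1 / 2 : ℝ) * rieszKernel x y ^ (1 / 2 : ℝ) =
            rieszKernel x y := by
          rw [← ENNReal.rpow_add_of_nonneg _ _ (by norm_num) (by norm_num)]
          norm_num
        have e2 : bracketWeight (-a / 2) y * bracketWeight (a / 2) y = 1 := by
          rw [bracketWeight_mul, ← bracketWeight_zero y]
          congr 1
          ring
        calc rieszKernel x y * G y = (rieszKernel x y ^ (1 / 2 : ℝ) *
              rieszKernel x y ^ (1 / 2 : ℝ)) * (bracketWeight (-a / 2) y *
              bracketWeight (a / 2) y) * G y := by rw [e1, e2, mul_one]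
          _ = _ := by ring
    _ ≤ _ := sq_lintegral_mul_le
        ((hk.pow_const _).mul (measurable_bracketWeight _)).aemeasurable
        ((hk.pow_const _).aemeasurable.mul ((measurable_bracketWeight _).aemeasurable.mul hG))
    _ = (∫⁻ y, rieszKernel x y * bracketWeight (-a) y) *
        ∫⁻ y, rieszKernel x y * (bracketWeight a y * G y ^ 2) := by
        have e1 : ∀ y, (rieszKernel x y ^ (1 / 2 : ℝ)) ^ 2 = rieszKernel x y := fun y => by
          rw [← ENNReal.rpow_two, ← ENNReal.rpow_mul]
          norm_num
        have e2 : ∀ (a : ℝ) y, bracketWeight (a / 2) y ^ 2 = bracketWeight a y := fun a y => by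
          rw [sq, bracketWeight_mul]
          ring_nf
        simp_rw [mul_pow, e1, e2]

/-- The Riesz potential of order one maps `L^{2,s}` to `L^{2,s-1}` for `-1/2 < s < 3/2`. -/
theorem exists_lintegral_rieszPotential_le {s : ℝ} (hs1 : -1 / 2 < s) (hs2 : s < 3 / 2) :
    ∃ C : ENNReal, C ≠ ⊤ ∧ ∀ G : R3 → ENNReal, AEMeasurable G →
      ∫⁻ x, bracketWeight (2 * (s - 1)) x * rieszPotential G x ^ 2 ≤
        C * ∫⁻ x, bracketWeight (2 * s) x * G x ^ 2 := by
  -- With test exponent `s + 3/2` the first integral contributes `⟨x⟩^(-1/2-s)`, which combines with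
  -- `⟨x⟩^(2(s-1))` to `⟨x⟩^(-(5/2-s))`. The integral in `x` then contributes `⟨y⟩^(s-3/2)`, and the
  -- weight `⟨y⟩^(2s)` results. Each exponent lies in `(1, 3)` exactly when `-1/2 < s < 3/2`.
  obtain ⟨C1, hC1, h1⟩ := exists_lintegral_rieszKernel_mul_le (t := s + 3 / 2) (by linarith)
    (by linarith)
  obtain ⟨C2, hC2, h2⟩ := exists_lintegral_rieszKernel_mul_le (t := 5 / 2 - s) (by linarith)
    (by linarith)
  refine ⟨C1 * C2, by finiteness, fun G hG => ?_⟩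
  have hpt : ∀ x, rieszPotential G x ^ 2 ≤ C1 * bracketWeight (1 - (s + 3 / 2)) x *
      ∫⁻ y, rieszKernel x y * (bracketWeight (s + 3 / 2) y * G y ^ 2) := fun x =>
    (sq_rieszPotential_le (s + 3 / 2) hG x).trans (mul_le_mul_left (h1 x) _)
  calc ∫⁻ x, bracketWeight (2 * (s - 1)) x * rieszPotential G x ^ 2
      ≤ ∫⁻ x, C1 * ∫⁻ y, bracketWeight (-(5 / 2 - s)) x *
          (rieszKernel x y * (bracketWeight (s + 3 / 2) y * G y ^ 2)) := by
        refine lintegral_mono fun x => ?_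
        rw [lintegral_const_mul' _ _ (bracketWeight_ne_top _ _)]
        calc _ ≤ bracketWeight (2 * (s - 1)) x * _ := mul_le_mul_right (hpt x) _
          _ = C1 * ((bracketWeight (2 * (s - 1)) x * bracketWeight (1 - (s + 3 / 2)) x) *
            ∫⁻ y, rieszKernel x y * (bracketWeight (s + 3 / 2) y * G y ^ 2)) := by ring
          _ ≤ _ := by
            rw [bracketWeight_mul]
            ring_nf
            exact le_rfl
    _ = C1 * ∫⁻ y, ∫⁻ x, bracketWeight (-(5 / 2 - s)) x *
          (rieszKernel x y * (bracketWeight (s + 3 / 2) y * G y ^ 2)) := by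
        rw [lintegral_const_mul' _ _ hC1, lintegral_lintegral_swap]
        have hG2 : AEMeasurable (fun p : R3 × R3 => G p.2) (volume.prod volume) :=
          hG.comp_quasiMeasurePreserving Measure.quasiMeasurePreserving_snd
        exact ((measurable_bracketWeight _).comp measurable_fst).aemeasurable.mul
          (measurable_rieszKernel.aemeasurable.mul
            (((measurable_bracketWeight _).comp measurable_snd).aemeasurable.mul (hG2.pow_const 2)))
    _ ≤ C1 * ∫⁻ y, C2 * (bracketWeight (2 * s) y * G y ^ 2) := by
        gcongr with y
        calc ∫⁻ x, bracketWeight (-(5 / 2 - s)) x *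
              (rieszKernel x y * (bracketWeight (s + 3 / 2) y * G y ^ 2))
            = (∫⁻ x, rieszKernel y x * bracketWeight (-(5 / 2 - s)) x) *
              (bracketWeight (s + 3 / 2) y * G y ^ 2) := by
              rw [← lintegral_mul_const]
              · refine lintegral_congr fun x => ?_
                rw [rieszKernel_comm]
                ring
              · exact (measurable_rieszKernel_left y).mul (measurable_bracketWeight _)
          _ ≤ (C2 * bracketWeight (1 - (5 / 2 - s)) y) *
              (bracketWeight (s + 3 / 2) y * G y ^ 2) := by
              gcongr
              exact h2 y
          _ = C2 * ((bracketWeight (1 - (5 / 2 - s)) y * bracketWeight (s + 3 / 2) y) *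
              G y ^ 2) := by ring
          _ = _ := by
              rw [bracketWeight_mul]
              ring_nf
    _ = C1 * C2 * ∫⁻ x, bracketWeight (2 * s) x * G x ^ 2 := by
        rw [lintegral_const_mul' _ _ hC2, mul_assoc]

/-! ### Integrability against weighted spaces -/

theorem memLp_two_japaneseBracket_rpow {t : ℝ} (ht : 3 / 2 < t) :
    MemLp (fun x : R3 => japaneseBracket x ^ (-t)) 2 volume := by
  rw [memLp_two_iff_integrable_sq (continuous_japaneseBracket_rpow _).aestronglyMeasurable]
  have h := integrable_rpow_neg_one_add_norm_sq (E := R3) (μ := volume) (r := 2 * t)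
    (by simp; linarith)
  refine h.congr (.of_forall fun x => ?_)
  simp only
  rw [← Real.rpow_natCast (_ ^ _) 2, ← Real.rpow_mul (japaneseBracket_pos x).le,
    japaneseBracket_rpow]
  push_cast
  ring_nf

/-- Hölder for `⟨y⟩^(-s) h` and `⟨y⟩^s f`: the first is dominated by `⟨y⟩^(-(s+t))`, which is square
integrable on `ℝ³` once `s + t > 3/2`. -/
theorem MemWeightedL2.integrable_smul {s t B : ℝ} {f : R3 → Spinor} (hf : MemWeightedL2 s f)
    {h : R3 → ℂ} (hh : AEStronglyMeasurable h volume)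
    (hB : ∀ y, ‖h y‖ ≤ B * japaneseBracket y ^ (-t)) (hst : 3 / 2 < s + t) :
    Integrable (fun y => h y • f y) := by
  have h1 : MemLp (fun y => (japaneseBracket y ^ (-s)) • h y) 2 volume := by
    refine (memLp_two_japaneseBracket_rpow hst).of_le_mul (c := B)
      ((continuous_japaneseBracket_rpow _).aestronglyMeasurable.smul hh) (.of_forall fun y => ?_)
    rw [norm_smul, Real.norm_of_nonneg (japaneseBracket_rpow_pos _ _).le,
      Real.norm_of_nonneg (japaneseBracket_rpow_pos _ _).le]
    calc japaneseBracket y ^ (-s) * ‖h y‖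
        ≤ japaneseBracket y ^ (-s) * (B * japaneseBracket y ^ (-t)) :=
          mul_le_mul_of_nonneg_left (hB y) (japaneseBracket_rpow_pos _ _).le
      _ = B * (japaneseBracket y ^ (-s) * japaneseBracket y ^ (-t)) := by ring
      _ = _ := by
        rw [← Real.rpow_add (japaneseBracket_pos y)]
        ring_nf
  have h2 := memLp_one_iff_integrable.1 (MemLp.smul (r := 1) hf h1)
  refine h2.congr (.of_forall fun y => ?_)
  change (japaneseBracket y ^ (-s) • h y) • (japaneseBracket y ^ s • f y) = h y • f y
  rw [smul_assoc, smul_comm (h y), smul_smul, ← Real.rpow_add (japaneseBracket_pos y)]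
  simp

theorem exists_norm_le_japaneseBracket_rpow {F : Type*} [NormedAddCommGroup F] [NormedSpace ℝ F]
    {h : R3 → F} (hc : Continuous h) (hs : HasCompactSupport h) (t : ℝ) :
    ∃ B, 0 ≤ B ∧ ∀ y, ‖h y‖ ≤ B * japaneseBracket y ^ t := by
  obtain ⟨B, hB⟩ := HasCompactSupport.exists_bound_of_continuous
    (f := fun y => (japaneseBracket y ^ (-t)) • h y) hs.smul_left
    ((continuous_japaneseBracket_rpow _).smul hc)
  refine ⟨B, (norm_nonneg _).trans (hB 0), fun y => ?_⟩
  have h1 := hB y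
  rw [norm_smul, Real.norm_of_nonneg (japaneseBracket_rpow_pos _ _).le,
    Real.rpow_neg (japaneseBracket_pos y).le] at h1
  rwa [inv_mul_le_iff₀ (japaneseBracket_rpow_pos _ _), mul_comm] at h1

theorem MemWeightedL2.integrable_smul_of_hasCompactSupport {s : ℝ} {f : R3 → Spinor}
    (hf : MemWeightedL2 s f) {h : R3 → ℂ} (hc : Continuous h) (hs : HasCompactSupport h) :
    Integrable (fun y => h y • f y) := by
  -- Compact support allows any decay rate; `2 - s` makes the sum of exponents `2 > 3/2`.
  obtain ⟨B, -, hB⟩ := exists_norm_le_japaneseBracket_rpow hc hs (-(2 - s))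
  exact hf.integrable_smul hc.aestronglyMeasurable hB (by linarith)

theorem MemWeightedL2.matAct {s : ℝ} {f : R3 → Spinor} (hf : MemWeightedL2 s f)
    (A : Matrix (Fin 4) (Fin 4) ℂ) : MemWeightedL2 s (fun x => matAct A (f x)) := by
  refine hf.of_le (c := ‖matCLM A‖)
    ((matCLM A).continuous.comp_aestronglyMeasurable hf.aestronglyMeasurable) fun x => ?_
  simpa [matCLM_apply] using (matCLM A).le_opNorm (f x)

/-! ### Cutoff functions -/

/-- Smooth cutoffs, equal to `1` on the ball of radius `R` and supported in that of radius `2R`. -/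
theorem exists_cutoff : ∃ M : ℝ, 0 ≤ M ∧ ∀ R : ℝ, 0 < R → ∃ χ : R3 → ℝ, ContDiff ℝ ∞ χ ∧
    HasCompactSupport χ ∧ (∀ y, 0 ≤ χ y ∧ χ y ≤ 1) ∧ (∀ y, ‖y‖ < R → χ y = 1) ∧
    (∀ y, ‖fderiv ℝ χ y‖ ≤ M / R) ∧
    (∀ y, ‖y‖ < R ∨ 2 * R < ‖y‖ → fderiv ℝ χ y = 0) := by
  let η : ContDiffBump (0 : R3) := ⟨1, 2, one_pos, one_lt_two⟩
  have hη : ContDiff ℝ ∞ η := η.contDiff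
  obtain ⟨M, hM⟩ := HasCompactSupport.exists_bound_of_continuous
    (η.hasCompactSupport.fderiv (𝕜 := ℝ)) (hη.continuous_fderiv (by simp))
  refine ⟨M, (norm_nonneg _).trans (hM 0), fun R hR => ⟨fun y => η (R⁻¹ • y), ?_, ?_, ?_, ?_, ?_, ?_⟩⟩
  · exact hη.comp (contDiff_const_smul _)
  · exact η.hasCompactSupport.comp_homeomorph (Homeomorph.smulOfNeZero R⁻¹ (inv_ne_zero hR.ne'))
  · exact fun y => ⟨η.nonneg, η.le_one⟩
  · intro y hy
    refine η.one_of_mem_closedBall ?_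
    rw [mem_closedBall_zero_iff, norm_smul, norm_inv, Real.norm_of_nonneg hR.le,
      inv_mul_le_iff₀ hR]
    change ‖y‖ ≤ R * 1
    linarith
  · intro y
    rw [fderiv_comp_smul, norm_smul, norm_inv, Real.norm_of_nonneg hR.le, div_eq_inv_mul]
    exact mul_le_mul_of_nonneg_left (hM _) (by positivity)
  · intro y hy
    rcases hy with hy | hy
    · have h1 : (fun y => η (R⁻¹ • y)) =ᶠ[𝓝 y] fun _ => 1 := by
        filter_upwards [(isOpen_lt continuous_norm continuous_const).mem_nhds hy] with z hz
        refine η.one_of_mem_closedBall ?_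
        rw [mem_closedBall_zero_iff, norm_smul, norm_inv, Real.norm_of_nonneg hR.le,
          inv_mul_le_iff₀ hR]
        change ‖z‖ ≤ R * 1
        have : ‖z‖ < R := hz
        linarith
      rw [h1.fderiv_eq]
      simp
    · have h1 : (fun y => η (R⁻¹ • y)) =ᶠ[𝓝 y] fun _ => 0 := by
        filter_upwards [(isOpen_lt continuous_const continuous_norm).mem_nhds hy] with z hz
        refine η.zero_of_le_dist ?_
        have : 2 * R < ‖z‖ := hz
        rw [dist_zero_right, norm_smul, norm_inv, Real.norm_of_nonneg hR.le, ← div_eq_inv_mul,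
          le_div_iff₀ hR]
        exact this.le
      rw [h1.fderiv_eq]
      simp

/-! ### The weak Dirac equation -/

/-- The weak form of `∑ⱼ αⱼ (-i ∂ⱼ f) + g = 0`. -/
def IsWeakDirac (f g : R3 → Spinor) : Prop :=
  ∀ φ : R3 → ℂ, ContDiff ℝ ∞ φ → HasCompactSupport φ →
    ∫ x, ((∑ j : Fin 3, (Complex.I * fderiv ℝ φ x (EuclideanSpace.single j 1)) •
      matAct (diracAlpha j) (f x)) + φ x • g x) = 0

theorem integrable_weakDirac {s t : ℝ} {f g : R3 → Spinor} (hf : MemWeightedL2 s f)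
    (hg : MemWeightedL2 t g) {φ : R3 → ℂ} (hφ : ContDiff ℝ ∞ φ) (hφs : HasCompactSupport φ) :
    Integrable fun x => (∑ j : Fin 3, (Complex.I * fderiv ℝ φ x (EuclideanSpace.single j 1)) •
      matAct (diracAlpha j) (f x)) + φ x • g x := by
  refine Integrable.add (integrable_finsetSum _ fun j _ => ?_)
    (hg.integrable_smul_of_hasCompactSupport hφ.continuous hφs)
  refine (hf.matAct (diracAlpha j)).integrable_smul_of_hasCompactSupport ?_ ?_
  · exact continuous_const.mul ((hφ.continuous_fderiv (by simp)).clm_apply continuous_const)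
  · exact (hφs.fderiv_apply (𝕜 := ℝ) _).mul_left

/-- Testing the weak Dirac equation with the product of a cutoff and a curl free field. -/
theorem IsWeakDirac.integral_cutoff_eq {s t : ℝ} {f g : R3 → Spinor} (h : IsWeakDirac f g)
    (hf : MemWeightedL2 s f) (hg : MemWeightedL2 t g) {b : Fin 3 → R3 → ℝ}
    (hb : ∀ k, ContDiff ℝ ∞ (b k))
    (hsymm : ∀ y j k, fderiv ℝ (b k) y (EuclideanSpace.single j 1) =
      fderiv ℝ (b j) y (EuclideanSpace.single k 1))
    {χ : R3 → ℝ} (hχ : ContDiff ℝ ∞ χ) (hχs : HasCompactSupport χ) :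
    ∫ y, ((χ y : ℂ) • ((Complex.I * (∑ j, fderiv ℝ (b j) y (EuclideanSpace.single j 1) : ℝ)) • f y +
        ∑ k, (b k y : ℂ) • matAct (diracAlpha k) (g y)) +
      ∑ k, ∑ j, (Complex.I * (b k y * fderiv ℝ χ y (EuclideanSpace.single j 1) : ℝ)) •
        matAct (diracAlpha k) (matAct (diracAlpha j) (f y))) = 0 := by
  -- One test function per component of the field; the `k`-th identity is multiplied by `αₖ` before
  -- summing.
  set φ : Fin 3 → R3 → ℂ := fun k y => ((χ y * b k y : ℝ) : ℂ) with hφdef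
  have hφ : ∀ k, ContDiff ℝ ∞ (φ k) := fun k =>
    Complex.ofRealCLM.contDiff.comp (hχ.mul (hb k))
  have hφs : ∀ k, HasCompactSupport (φ k) := fun k =>
    (hχs.mul_right (f' := b k)).comp_left (g := Complex.ofReal) Complex.ofReal_zero
  have hφ' : ∀ k y v, fderiv ℝ (φ k) y v =
      ((χ y * fderiv ℝ (b k) y v + b k y * fderiv ℝ χ y v : ℝ) : ℂ) := fun k y v => by
    have h1 : HasFDerivAt (fun y => χ y * b k y) (χ y • fderiv ℝ (b k) y + b k y • fderiv ℝ χ y) y :=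
      ((hχ.differentiable (by simp)) y).hasFDerivAt.mul
        (((hb k).differentiable (by simp)) y).hasFDerivAt
    have h2 := (Complex.ofRealCLM.hasFDerivAt (x := χ y * b k y)).comp y h1
    have h3 : fderiv ℝ (φ k) y = _ := h2.fderiv
    rw [h3]
    simp
  have hz : ∀ k, ∫ y, matCLM (diracAlpha k) ((∑ j : Fin 3, (Complex.I *
      fderiv ℝ (φ k) y (EuclideanSpace.single j 1)) • matAct (diracAlpha j) (f y)) +
        φ k y • g y) = 0 := fun k => by
    rw [ContinuousLinearMap.integral_comp_comm _ (integrable_weakDirac hf hg (hφ k) (hφs k)),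
      h _ (hφ k) (hφs k), map_zero]
  have hsum := integral_finsetSum Finset.univ (μ := volume) (f := fun k y =>
      matCLM (diracAlpha k) ((∑ j : Fin 3, (Complex.I *
      fderiv ℝ (φ k) y (EuclideanSpace.single j 1)) • matAct (diracAlpha j) (f y)) +
        φ k y • g y)) fun k _ =>
      (matCLM (diracAlpha k)).integrable_comp (integrable_weakDirac hf hg (hφ k) (hφs k))
  simp only [hz, Finset.sum_const_zero] at hsum
  rw [← hsum]
  refine integral_congr_ae (.of_forall fun y => ?_)
  -- Being curl free means that the Jacobian is symmetric, so its contraction with `αₖ αⱼ` keeps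
  -- only the trace, the divergence. The derivatives falling on the cutoff have no such symmetry and
  -- stay as the error term.
  have hkey := sum_smul_diracAlpha_diracAlpha
    (fun k j => ((fderiv ℝ (b k) y (EuclideanSpace.single j 1) : ℝ) : ℂ))
    (fun k j => by rw [hsymm]) (f y)
  have hφy : ∀ k, φ k y = ((χ y * b k y : ℝ) : ℂ) := fun _ => rfl
  simp only [map_add, map_sum, map_smul, matCLM_apply, hφ', hφy]
  have hL : ((∑ j, fderiv ℝ (b j) y (EuclideanSpace.single j 1) : ℝ) : ℂ) • f y =
      ∑ k, ∑ j, ((fderiv ℝ (b k) y (EuclideanSpace.single j 1) : ℝ) : ℂ) •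
        matAct (diracAlpha k) (matAct (diracAlpha j) (f y)) := by
    rw [hkey]
    push_cast
    rfl
  rw [mul_smul, hL]
  simp only [smul_add, Finset.smul_sum, smul_smul, ← Finset.sum_add_distrib]
  refine Finset.sum_congr rfl fun k _ => ?_
  rw [add_right_comm, ← Finset.sum_add_distrib]
  congr 1
  · refine Finset.sum_congr rfl fun j _ => ?_
    rw [← add_smul]
    congr 1
    push_cast
    ring
  · push_cast
    rfl

/-! ### Removing the cutoff -/

theorem lintegral_sq_indicator_closedBall {R : ℝ} (hR : 0 < R) (c : ℝ) (hc : 0 ≤ c) :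
    ∫⁻ y, ((Metric.closedBall (0 : R3) (2 * R)).indicator
      (fun _ => ENNReal.ofReal (c * R ^ (-(3 / 2) : ℝ))) y) ^ 2 =
        ENNReal.ofReal (8 * c ^ 2) * volume (Metric.ball (0 : R3) 1) := by
  have h : ∀ y, ((Metric.closedBall (0 : R3) (2 * R)).indicator
      (fun _ => ENNReal.ofReal (c * R ^ (-(3 / 2) : ℝ))) y) ^ 2 =
      (Metric.closedBall (0 : R3) (2 * R)).indicator
        (fun _ => ENNReal.ofReal (c * R ^ (-(3 / 2) : ℝ)) ^ 2) y := fun y => by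
    by_cases hy : y ∈ Metric.closedBall (0 : R3) (2 * R) <;> simp [hy]
  simp_rw [h]
  rw [lintegral_indicator_const measurableSet_closedBall, Measure.addHaar_closedBall _ _
    (by positivity), ← mul_assoc, ← ENNReal.ofReal_pow (by positivity),
    ← ENNReal.ofReal_mul (by positivity)]
  congr 2
  -- The exponent `-3/2` is half the dimension: the square `R⁻³` cancels the volume growth, leaving
  -- a bound independent of `R`.
  have h2 : (R ^ (-(3 / 2) : ℝ)) ^ 2 = (R ^ 3)⁻¹ := by
    rw [← Real.rpow_natCast, ← Real.rpow_mul hR.le, ← Real.rpow_natCast, ← Real.rpow_neg hR.le]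
    norm_num
  rw [mul_pow, h2]
  simp
  field_simp
  norm_num

/-- Errors supported in dyadic annuli and of critical decay vanish in the limit. -/
theorem tendsto_integral_annulus {f : R3 → Spinor} (hf : MemWeightedL2 (-3 / 2) f) {c : ℝ}
    (hc : 0 ≤ c) {E : ℕ → R3 → Spinor}
    (hE : ∀ n y, ‖E n y‖ ≤ c / (n + 1) * japaneseBracket y ^ (-2 : ℝ) * ‖f y‖)
    (hsupp : ∀ (n : ℕ) y, ‖y‖ < n + 1 ∨ 2 * ((n : ℝ) + 1) < ‖y‖ → E n y = 0) :
    Tendsto (fun n => ∫ y, E n y) atTop (𝓝 0) := by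
  -- On the annulus, `⟨y⟩⁻² |f| = ⟨y⟩^(-1/2) · ⟨y⟩^(-3/2) |f|` and `⟨y⟩^(-1/2) ≤ (n+1)^(-1/2)`. So
  -- the error is at most `A n * F n`, where `A n` has bounded `L²` norm and `F n` is a tail of a
  -- fixed `L²` function.
  set A : ℕ → R3 → ENNReal := fun n => (Metric.closedBall (0 : R3) (2 * ((n : ℝ) + 1))).indicator
      (fun _ => ENNReal.ofReal (c * ((n : ℝ) + 1) ^ (-(3 / 2) : ℝ))) with hA
  set F : ℕ → R3 → ENNReal := fun n => {y : R3 | (n : ℝ) + 1 ≤ ‖y‖}.indicator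
      (fun y => ‖weighted (-3 / 2) f y‖ₑ) with hF
  have hSm : ∀ n : ℕ, MeasurableSet {y : R3 | (n : ℝ) + 1 ≤ ‖y‖} := fun n =>
    measurableSet_le measurable_const measurable_norm
  have hwm : AEMeasurable (fun y => ‖weighted (-3 / 2) f y‖ₑ) := (MemLp.aestronglyMeasurable hf).enorm
  have hle : ∀ n y, ‖E n y‖ₑ ≤ A n y * F n y := fun n y => by
    by_cases hy : ‖y‖ < n + 1 ∨ 2 * ((n : ℝ) + 1) < ‖y‖
    · simp [hsupp n y hy]
    · push Not at hy
      have h1 : y ∈ Metric.closedBall (0 : R3) (2 * ((n : ℝ) + 1)) := by simpa using hy.2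
      have h2 : y ∈ {y : R3 | (n : ℝ) + 1 ≤ ‖y‖} := hy.1
      simp only [hA, hF, Set.indicator_of_mem h1, Set.indicator_of_mem h2]
      rw [← ofReal_norm, ← ofReal_norm, ← ENNReal.ofReal_mul (by positivity)]
      refine ENNReal.ofReal_le_ofReal ((hE n y).trans ?_)
      rw [weighted, norm_smul, Real.norm_of_nonneg (japaneseBracket_rpow_pos _ _).le]
      have hn : (0 : ℝ) < n + 1 := by positivity
      have h3 : japaneseBracket y ^ (-(1 / 2) : ℝ) ≤ ((n : ℝ) + 1) ^ (-(1 / 2) : ℝ) :=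
        Real.rpow_le_rpow_of_nonpos hn (hy.1.trans (norm_le_japaneseBracket y)) (by norm_num)
      have h4 : japaneseBracket y ^ (-2 : ℝ) =
          japaneseBracket y ^ (-(1 / 2) : ℝ) * japaneseBracket y ^ (-3 / 2 : ℝ) := by
        rw [← Real.rpow_add (japaneseBracket_pos y)]
        norm_num
      have h5 : ((n : ℝ) + 1) ^ (-(3 / 2) : ℝ) = ((n : ℝ) + 1) ^ (-(1 / 2) : ℝ) / (n + 1) := by
        rw [← Real.rpow_sub_one hn.ne']
        norm_num
      rw [h4, h5]
      have h6 := japaneseBracket_rpow_pos y (-3 / 2)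
      calc c / (n + 1) * (japaneseBracket y ^ (-(1 / 2) : ℝ) * japaneseBracket y ^ (-3 / 2 : ℝ)) *
            ‖f y‖
          ≤ c / (n + 1) * (((n : ℝ) + 1) ^ (-(1 / 2) : ℝ) * japaneseBracket y ^ (-3 / 2 : ℝ)) *
            ‖f y‖ := by gcongr
        _ = _ := by ring
  have hF0 : Tendsto (fun n => ∫⁻ y, F n y ^ 2) atTop (𝓝 0) := by
    have h0 : ∫⁻ _y : R3, (0 : ENNReal) = 0 := lintegral_zero
    rw [← h0]
    refine tendsto_lintegral_of_dominated_convergence' (fun y => ‖weighted (-3 / 2) f y‖ₑ ^ 2)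
      (fun n => (hwm.indicator (hSm n)).pow_const 2) (fun n => .of_forall fun y => ?_) ?_
      (.of_forall fun y => ?_)
    · exact pow_le_pow_left' (Set.indicator_le_self _ _ y) 2
    · have := (memWeightedL2_iff hf.aestronglyMeasurable).1 hf
      simp_rw [← enorm_weighted_rpow_two, ENNReal.rpow_two] at this
      exact this.ne
    · refine tendsto_const_nhds.congr' ?_
      filter_upwards [eventually_gt_atTop ⌈‖y‖⌉₊] with n hn
      have h1 : y ∉ {y : R3 | (n : ℝ) + 1 ≤ ‖y‖} := by
        have : ‖y‖ < n := Nat.lt_of_ceil_lt hn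
        simp only [Set.mem_ofPred_eq, not_le]
        linarith
      simp [hF, h1]
  have hint : ∀ n, ‖∫ y, E n y‖ₑ ≤ ((ENNReal.ofReal (8 * c ^ 2) *
      volume (Metric.ball (0 : R3) 1)) * ∫⁻ y, F n y ^ 2) ^ (1 / 2 : ℝ) := fun n => by
    have h1 : ‖∫ y, E n y‖ₑ ≤ ∫⁻ y, A n y * F n y :=
      (enorm_integral_le_lintegral_enorm _).trans (lintegral_mono (hle n))
    have h2 := sq_lintegral_mul_le (f := A n) (g := F n)
      (measurable_const.indicator measurableSet_closedBall).aemeasurable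
      (hwm.indicator (hSm n))
    rw [lintegral_sq_indicator_closedBall (by positivity) c hc] at h2
    calc ‖∫ y, E n y‖ₑ = (‖∫ y, E n y‖ₑ ^ 2) ^ (1 / 2 : ℝ) := by
          rw [← ENNReal.rpow_two, ← ENNReal.rpow_mul]
          norm_num
      _ ≤ _ := ENNReal.rpow_le_rpow ((pow_le_pow_left' h1 2).trans h2) (by norm_num)
  have hlim : Tendsto (fun n => ((ENNReal.ofReal (8 * c ^ 2) *
      volume (Metric.ball (0 : R3) 1)) * ∫⁻ y, F n y ^ 2) ^ (1 / 2 : ℝ)) atTop (𝓝 0) := by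
    have h1 := ENNReal.Tendsto.const_mul (a := ENNReal.ofReal (8 * c ^ 2) *
      volume (Metric.ball (0 : R3) 1)) hF0 (Or.inr (by
        have := (measure_ball_lt_top (μ := volume) (x := (0 : R3)) (r := 1)).ne
        finiteness))
    have h2 := (ENNReal.continuous_rpow_const (y := (1 / 2 : ℝ))).tendsto _ |>.comp h1
    simpa [Function.comp_def] using h2
  have h3 : Tendsto (fun n => ‖∫ y, E n y‖ₑ) atTop (𝓝 0) :=
    tendsto_of_tendsto_of_tendsto_of_le_of_le tendsto_const_nhds hlim (fun _ => zero_le) hint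
  rw [tendsto_zero_iff_norm_tendsto_zero]
  have h4 := (ENNReal.tendsto_toReal ENNReal.zero_ne_top).comp h3
  simpa [Function.comp_def] using h4

theorem norm_diracAlpha_le (k : Fin 3) (v : Spinor) : ‖matAct (diracAlpha k) v‖ ≤ 8 * ‖v‖ := by
  have h : ∀ i j, ‖diracAlpha k i j‖ ≤ 1 := by
    intro i j
    fin_cases k <;> fin_cases i <;> fin_cases j <;>
      simp [diracAlpha, pauli, finSumFinEquiv, Fin.addCases]
  simpa using norm_matAct_le zero_le_one h v

/-- Testing the weak Dirac equation with a curl free field of critical decay. -/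
theorem IsWeakDirac.integral_eq {t : ℝ} {f g : R3 → Spinor} (h : IsWeakDirac f g)
    (hf : MemWeightedL2 (-3 / 2) f) (ht : -1 / 2 < t) (hg : MemWeightedL2 t g)
    {b : Fin 3 → R3 → ℝ} (hb : ∀ k, ContDiff ℝ ∞ (b k))
    (hsymm : ∀ y j k, fderiv ℝ (b k) y (EuclideanSpace.single j 1) =
      fderiv ℝ (b j) y (EuclideanSpace.single k 1))
    {B : ℝ} (hB : 0 ≤ B) (hbB : ∀ k y, |b k y| ≤ B * japaneseBracket y ^ (-2 : ℝ))
    (hdiv : ∀ y, |∑ j, fderiv ℝ (b j) y (EuclideanSpace.single j 1)| ≤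
      B * japaneseBracket y ^ (-5 : ℝ)) :
    ∫ y, ((Complex.I * (∑ j, fderiv ℝ (b j) y (EuclideanSpace.single j 1) : ℝ)) • f y +
        ∑ k, (b k y : ℂ) • matAct (diracAlpha k) (g y)) = 0 := by
  obtain ⟨M, hM, hcut⟩ := exists_cutoff
  choose! χ hχ hχs hχ01 hχ1 hχM hχ0 using hcut
  set P : R3 → Spinor := fun y =>
    (Complex.I * (∑ j, fderiv ℝ (b j) y (EuclideanSpace.single j 1) : ℝ)) • f y +
        ∑ k, (b k y : ℂ) • matAct (diracAlpha k) (g y) with hP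
  have hdc : ∀ k j, Continuous fun y => fderiv ℝ (b k) y (EuclideanSpace.single j 1) := fun k j =>
    ((hb k).continuous_fderiv (by simp)).clm_apply continuous_const
  have hPi : Integrable P := by
    -- The exponents suffice: `-3/2 + 5 > 3/2` for the divergence term, and `t + 2 > 3/2` for the
    -- source, which is the hypothesis `t > -1/2`.
    refine Integrable.add (hf.integrable_smul (t := 5) (B := B) ?_ ?_ (by norm_num))
      (integrable_finsetSum _ fun k _ => (hg.matAct _).integrable_smul (t := 2) (B := B)
        ?_ ?_ (by linarith))
    · exact (continuous_const.mul (Complex.continuous_ofReal.comp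
        (continuous_finsetSum _ fun j _ => hdc j j))).aestronglyMeasurable
    · intro y
      rw [norm_mul, Complex.norm_I, one_mul, Complex.norm_real, Real.norm_eq_abs]
      exact hdiv y
    · exact (Complex.continuous_ofReal.comp (hb k).continuous).aestronglyMeasurable
    · intro y
      rw [Complex.norm_real, Real.norm_eq_abs]
      exact hbB k y
  set r : ℕ → ℝ := fun n => n + 1 with hr
  have hrpos : ∀ n, 0 < r n := fun n => by positivity
  set E : ℕ → R3 → Spinor := fun n y =>
    ∑ k, ∑ j, (Complex.I * (b k y * fderiv ℝ (χ (r n)) y (EuclideanSpace.single j 1) : ℝ)) •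
        matAct (diracAlpha k) (matAct (diracAlpha j) (f y)) with hEdef
  have hE0 : Tendsto (fun n => ∫ y, E n y) atTop (𝓝 0) := by
    -- Nine index pairs, and a factor 8 for each of the two Dirac matrices.
    refine tendsto_integral_annulus hf (c := 9 * (B * M * 64)) (by positivity) ?_ ?_
    · intro n y
      have hterm : ∀ k j, ‖(Complex.I * (b k y *
          fderiv ℝ (χ (r n)) y (EuclideanSpace.single j 1) : ℝ)) •
          matAct (diracAlpha k) (matAct (diracAlpha j) (f y))‖ ≤
          (B * M * 64) / (n + 1) * japaneseBracket y ^ (-2 : ℝ) * ‖f y‖ := fun k j => by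
        rw [norm_smul, norm_mul, Complex.norm_I, one_mul, Complex.norm_real, norm_mul]
        have h1 : ‖fderiv ℝ (χ (r n)) y (EuclideanSpace.single j 1)‖ ≤ M / (n + 1) := by
          have := ((fderiv ℝ (χ (r n)) y).le_opNorm (EuclideanSpace.single j 1))
          simp only [PiLp.norm_single, norm_one, mul_one] at this
          exact this.trans (hχM _ (hrpos n) y)
        have h2 : ‖matAct (diracAlpha k) (matAct (diracAlpha j) (f y))‖ ≤ 8 * (8 * ‖f y‖) :=
          (norm_diracAlpha_le _ _).trans (by
            have := norm_diracAlpha_le j (f y)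
            linarith)
        have h3 : ‖b k y‖ ≤ B * japaneseBracket y ^ (-2 : ℝ) := hbB k y
        have h4 := japaneseBracket_rpow_pos y (-2)
        calc ‖b k y‖ * ‖fderiv ℝ (χ (r n)) y (EuclideanSpace.single j 1)‖ * _
            ≤ (B * japaneseBracket y ^ (-2 : ℝ)) * (M / (n + 1)) * (8 * (8 * ‖f y‖)) := by gcongr
          _ = _ := by ring
      calc ‖E n y‖ ≤ ∑ k : Fin 3, ∑ j : Fin 3,
            (B * M * 64) / (n + 1) * japaneseBracket y ^ (-2 : ℝ) * ‖f y‖ :=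
            (norm_sum_le _ _).trans (Finset.sum_le_sum fun k _ =>
              (norm_sum_le _ _).trans (Finset.sum_le_sum fun j _ => hterm k j))
        _ = _ := by
          simp
          ring
    · intro n y hy
      simp only [hEdef, hχ0 _ (hrpos n) y hy]
      simp
  have hEi : ∀ n, Integrable (E n) := fun n => by
    refine integrable_finsetSum _ fun k _ => integrable_finsetSum _ fun j _ => ?_
    refine ((hf.matAct (diracAlpha j)).matAct
      (diracAlpha k)).integrable_smul_of_hasCompactSupport ?_ ?_
    · exact continuous_const.mul (Complex.continuous_ofReal.comp ((hb k).continuous.mul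
        (((hχ _ (hrpos n)).continuous_fderiv (by simp)).clm_apply continuous_const)))
    · refine HasCompactSupport.mul_left (HasCompactSupport.comp_left (g := Complex.ofReal) ?_
        Complex.ofReal_zero)
      exact ((hχs _ (hrpos n)).fderiv_apply (𝕜 := ℝ) _).mul_left
  have hχP : ∀ n y, ‖((χ (r n) y : ℝ) : ℂ) • P y‖ ≤ ‖P y‖ := fun n y => by
    rw [norm_smul, Complex.norm_real, Real.norm_of_nonneg (hχ01 _ (hrpos n) y).1]
    exact mul_le_of_le_one_left (norm_nonneg _) (hχ01 _ (hrpos n) y).2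
  have hχPm : ∀ n, AEStronglyMeasurable (fun y => ((χ (r n) y : ℝ) : ℂ) • P y) volume := fun n =>
    (Complex.continuous_ofReal.comp (hχ _ (hrpos n)).continuous).aestronglyMeasurable.smul
      hPi.aestronglyMeasurable
  have hlim : Tendsto (fun n => ∫ y, ((χ (r n) y : ℝ) : ℂ) • P y) atTop (𝓝 (∫ y, P y)) := by
    refine tendsto_integral_of_dominated_convergence (fun y => ‖P y‖) hχPm hPi.norm
      (fun n => .of_forall (hχP n)) (.of_forall fun y => ?_)
    refine tendsto_const_nhds.congr' ?_
    filter_upwards [eventually_gt_atTop ⌈‖y‖⌉₊] with n hn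
    have : ‖y‖ < n := Nat.lt_of_ceil_lt hn
    rw [hχ1 _ (hrpos n) y (this.trans (by simp [hr]))]
    simp
  have hzero : ∀ n, ∫ y, ((χ (r n) y : ℝ) : ℂ) • P y = -∫ y, E n y := fun n => by
    have h1 := h.integral_cutoff_eq hf hg hb hsymm (hχ _ (hrpos n)) (hχs _ (hrpos n))
    have h2 : Integrable fun y => ((χ (r n) y : ℝ) : ℂ) • P y :=
      Integrable.mono hPi (hχPm n) (.of_forall (hχP n))
    rw [eq_neg_iff_add_eq_zero, ← integral_add h2 (hEi n)]
    exact h1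
  simp_rw [hzero] at hlim
  have h2 := hE0.neg
  rw [neg_zero] at h2
  exact tendsto_nhds_unique hlim h2

/-! ### The regularized fundamental solution -/

/-- The components `zₖ ⟨z⟩⁻³` of the gradient of `-⟨z⟩⁻¹`. -/
def bracketField (k : Fin 3) (z : R3) : ℝ := z k * japaneseBracket z ^ (-3 : ℝ)

theorem contDiff_bracketField (k : Fin 3) : ContDiff ℝ ∞ (bracketField k) :=
  ContDiff.mul (by fun_prop) (contDiff_japaneseBracket_rpow _)

theorem fderiv_bracketField (k j : Fin 3) (z : R3) :
    fderiv ℝ (bracketField k) z (EuclideanSpace.single j 1) =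
      (if k = j then 1 else 0) * japaneseBracket z ^ (-3 : ℝ) -
        3 * (z k * z j) * japaneseBracket z ^ (-5 : ℝ) := by
  have h1 : HasFDerivAt (fun z : R3 => japaneseBracket z ^ (-3 : ℝ))
      ((2 * (-3 / 2) * (1 + ‖z‖ ^ 2) ^ ((-3 / 2 : ℝ) - 1)) • innerSL ℝ z) z := by
    simp_rw [japaneseBracket_rpow]
    exact hasFDerivAt_one_add_norm_sq_rpow (-3 / 2) z
  have h2 : HasFDerivAt (fun z : R3 => z k) (EuclideanSpace.proj (𝕜 := ℝ) k) z :=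
    (EuclideanSpace.proj (𝕜 := ℝ) k).hasFDerivAt
  have h3 : fderiv ℝ (bracketField k) z = _ := (h2.mul h1).fderiv
  rw [h3]
  have h4 : japaneseBracket z ^ (-5 : ℝ) = (1 + ‖z‖ ^ 2) ^ ((-3 / 2 : ℝ) - 1) := by
    rw [japaneseBracket_rpow]
    norm_num
  have h5 : inner ℝ z (EuclideanSpace.single j (1 : ℝ)) = z j := by
    rw [EuclideanSpace.inner_single_right]
    simp
  rw [h4]
  have h6 : EuclideanSpace.proj (𝕜 := ℝ) k (EuclideanSpace.single j (1 : ℝ)) =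
      if k = j then 1 else 0 := by
    simp
  simp only [_root_.add_apply, _root_.smul_apply, innerSL_apply_apply,
    h5, h6, smul_eq_mul]
  ring

theorem fderiv_bracketField_symm (z : R3) (j k : Fin 3) :
    fderiv ℝ (bracketField k) z (EuclideanSpace.single j 1) =
      fderiv ℝ (bracketField j) z (EuclideanSpace.single k 1) := by
  rw [fderiv_bracketField, fderiv_bracketField, mul_comm (z k)]
  simp only [eq_comm]

/-- The terms `3⟨z⟩⁻³` and `-3|z|²⟨z⟩⁻⁵` combine through `⟨z⟩² - |z|² = 1`. The divergence is thus
positive and integrable, which lets its rescalings serve as mollifiers; it regularizes `div (z/|z|³)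
= 4πδ`. -/
theorem sum_fderiv_bracketField (z : R3) :
    ∑ j, fderiv ℝ (bracketField j) z (EuclideanSpace.single j 1) =
      3 * japaneseBracket z ^ (-5 : ℝ) := by
  simp_rw [fderiv_bracketField]
  have h1 : japaneseBracket z ^ (-3 : ℝ) = (1 + ‖z‖ ^ 2) * japaneseBracket z ^ (-5 : ℝ) := by
    rw [← sq_japaneseBracket, ← Real.rpow_two, ← Real.rpow_add (japaneseBracket_pos z)]
    norm_num
  rw [h1, EuclideanSpace.real_norm_sq_eq]
  simp [Fin.sum_univ_three]
  ring

theorem abs_bracketField_le (k : Fin 3) (z : R3) :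
    |bracketField k z| ≤ ‖z‖ * japaneseBracket z ^ (-3 : ℝ) := by
  rw [bracketField, abs_mul, abs_of_pos (japaneseBracket_rpow_pos z _)]
  exact mul_le_mul_of_nonneg_right (PiLp.norm_apply_le z k) (japaneseBracket_rpow_pos z _).le

theorem abs_bracketField_le_rpow (k : Fin 3) (z : R3) :
    |bracketField k z| ≤ japaneseBracket z ^ (-2 : ℝ) := by
  refine (abs_bracketField_le k z).trans ?_
  have h : japaneseBracket z ^ (-2 : ℝ) = japaneseBracket z * japaneseBracket z ^ (-3 : ℝ) := by
    nth_rewrite 2 [← Real.rpow_one (japaneseBracket z)]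
    rw [← Real.rpow_add (japaneseBracket_pos z)]
    norm_num
  rw [h]
  exact mul_le_mul_of_nonneg_right (norm_le_japaneseBracket z) (japaneseBracket_rpow_pos z _).le

/-- This bound is homogeneous of degree `-2`, so it survives rescaling with no loss in `ε`. The
bound by `⟨z⟩⁻²` serves only for integrability at fixed `ε`. -/
theorem abs_bracketField_le_inv_sq (k : Fin 3) (z : R3) : |bracketField k z| ≤ (‖z‖ ^ 2)⁻¹ := by
  rcases eq_or_ne z 0 with rfl | hz
  · simp [bracketField]
  have hn : 0 < ‖z‖ := norm_pos_iff.2 hz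
  refine (abs_bracketField_le k z).trans ?_
  have h1 : japaneseBracket z ^ (-3 : ℝ) ≤ ‖z‖ ^ (-3 : ℝ) :=
    Real.rpow_le_rpow_of_nonpos hn (norm_le_japaneseBracket z) (by norm_num)
  calc ‖z‖ * japaneseBracket z ^ (-3 : ℝ) ≤ ‖z‖ * ‖z‖ ^ (-3 : ℝ) := by gcongr
    _ = (‖z‖ ^ 2)⁻¹ := by
      rw [Real.rpow_neg hn.le]
      norm_cast
      field_simp

/-- An approximate identity, up to a constant factor, centred at `x`. -/
def mollifier (ε : ℝ) (x y : R3) : ℝ :=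
  ε⁻¹ ^ 3 * (3 * japaneseBracket (ε⁻¹ • (y - x)) ^ (-5 : ℝ))

theorem mollifier_pos {ε : ℝ} (hε : 0 < ε) (x y : R3) : 0 < mollifier ε x y :=
  mul_pos (by positivity) (mul_pos three_pos (japaneseBracket_rpow_pos _ _))

theorem continuous_mollifier (ε : ℝ) : Continuous fun p : R3 × R3 => mollifier ε p.1 p.2 :=
  continuous_const.mul (continuous_const.mul
    ((continuous_japaneseBracket_rpow _).comp (by fun_prop)))

/-- A Peetre-type inequality, trading the weight centred at `x` on scale `ε` for the fixed weight
`⟨y⟩`. -/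
theorem japaneseBracket_le_mul_scaled {ε : ℝ} (hε : 0 < ε) (x y : R3) :
    japaneseBracket y ≤ (1 + ε) * japaneseBracket x * japaneseBracket (ε⁻¹ • (y - x)) := by
  have h1 := japaneseBracket_le_add y x
  have h2 : ‖y - x‖ = ε * ‖ε⁻¹ • (y - x)‖ := by
    rw [norm_smul, norm_inv, Real.norm_of_nonneg hε.le]
    field_simp
  have h3 := norm_le_japaneseBracket (ε⁻¹ • (y - x))
  have h4 := one_le_japaneseBracket x
  have h5 := one_le_japaneseBracket (ε⁻¹ • (y - x))
  set a := japaneseBracket x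
  set c := japaneseBracket (ε⁻¹ • (y - x))
  have h6 : ‖y - x‖ ≤ ε * c := by
    rw [h2]
    gcongr
  have h7 : ε * c ≤ ε * (a * c) := by
    gcongr
    nlinarith
  nlinarith

theorem scaled_japaneseBracket_rpow_le {ε t : ℝ} (hε : 0 < ε) (ht : 0 ≤ t) (x y : R3) :
    japaneseBracket (ε⁻¹ • (y - x)) ^ (-t) ≤
      ((1 + ε) * japaneseBracket x) ^ t * japaneseBracket y ^ (-t) := by
  have h1 := japaneseBracket_le_mul_scaled hε x y
  have hx := japaneseBracket_pos x
  have hy := japaneseBracket_pos y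
  have hz := japaneseBracket_pos (ε⁻¹ • (y - x))
  have h2 := Real.rpow_le_rpow hy.le h1 ht
  rw [Real.mul_rpow (by positivity) hz.le] at h2
  rw [Real.rpow_neg hz.le, Real.rpow_neg hy.le, ← div_eq_mul_inv, inv_le_comm₀ (by positivity)
    (by positivity), inv_div, div_le_iff₀ (by positivity)]
  linarith

/-- The test field is `ε⁻² b((y - x)/ε)` with `b` the `bracketField`; the chain rule supplies the
third factor `ε⁻¹`, so its divergence is exactly the mollifier. -/
theorem IsWeakDirac.integral_mollifier_eq {t : ℝ} {f g : R3 → Spinor} (h : IsWeakDirac f g)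
    (hf : MemWeightedL2 (-3 / 2) f) (ht : -1 / 2 < t) (hg : MemWeightedL2 t g) {ε : ℝ}
    (hε : 0 < ε) (x : R3) :
    ∫ y, ((Complex.I * (mollifier ε x y : ℝ)) • f y +
        ∑ k, ((ε⁻¹ ^ 2 * bracketField k (ε⁻¹ • (y - x)) : ℝ) : ℂ) •
          matAct (diracAlpha k) (g y)) = 0 := by
  have hbd : ∀ k y, fderiv ℝ (fun y => ε⁻¹ ^ 2 * bracketField k (ε⁻¹ • (y - x))) y =
      ε⁻¹ ^ 3 • fderiv ℝ (bracketField k) (ε⁻¹ • (y - x)) := fun k y => by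
    have h1 : HasFDerivAt (bracketField k) (fderiv ℝ (bracketField k) (ε⁻¹ • (y - x)))
        (ε⁻¹ • (y - x)) :=
      ((contDiff_bracketField k).differentiable (by simp) _).hasFDerivAt
    have h2 : HasFDerivAt (fun y : R3 => ε⁻¹ • (y - x)) (ε⁻¹ • ContinuousLinearMap.id ℝ R3) y :=
      ((hasFDerivAt_id y).sub_const x).const_smul ε⁻¹
    have h3 : fderiv ℝ (fun y => ε⁻¹ ^ 2 * bracketField k (ε⁻¹ • (y - x))) y = _ :=
      ((h1.comp y h2).const_mul (ε⁻¹ ^ 2)).fderiv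
    rw [h3]
    ext v
    simp
    ring
  have hdiv : ∀ y, ∑ j, fderiv ℝ (fun y => ε⁻¹ ^ 2 * bracketField j (ε⁻¹ • (y - x))) y
      (EuclideanSpace.single j 1) = mollifier ε x y := fun y => by
    simp_rw [hbd, _root_.smul_apply, smul_eq_mul]
    rw [← Finset.mul_sum, sum_fderiv_bracketField, mollifier]
  set B2 := ε⁻¹ ^ 2 * ((1 + ε) * japaneseBracket x) ^ (2 : ℝ) with hB2
  set B5 := ε⁻¹ ^ 3 * (3 * ((1 + ε) * japaneseBracket x) ^ (5 : ℝ)) with hB5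
  have hx := japaneseBracket_pos x
  have h2 : 0 < B2 := by positivity
  have h5 : 0 < B5 := by positivity
  have key := h.integral_eq hf ht hg
    (b := fun k y => ε⁻¹ ^ 2 * bracketField k (ε⁻¹ • (y - x))) (B := B2 + B5)
    (fun k => contDiff_const.mul ((contDiff_bracketField k).comp (by fun_prop)))
    (fun y j k => by
      rw [hbd, hbd, _root_.smul_apply, _root_.smul_apply, fderiv_bracketField_symm])
    (by positivity) (fun k y => ?_) (fun y => ?_)
  · simp_rw [hdiv] at key
    exact key
  · rw [abs_mul, abs_of_pos (by positivity)]
    calc ε⁻¹ ^ 2 * |bracketField k (ε⁻¹ • (y - x))|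
        ≤ ε⁻¹ ^ 2 * (((1 + ε) * japaneseBracket x) ^ (2 : ℝ) * japaneseBracket y ^ (-2 : ℝ)) := by
          gcongr
          exact (abs_bracketField_le_rpow k _).trans
            (scaled_japaneseBracket_rpow_le hε zero_le_two x y)
      _ = B2 * japaneseBracket y ^ (-2 : ℝ) := by ring
      _ ≤ _ := mul_le_mul_of_nonneg_right (by linarith) (japaneseBracket_rpow_pos y _).le
  · rw [hdiv, abs_of_pos (mollifier_pos hε x y), mollifier]
    calc ε⁻¹ ^ 3 * (3 * japaneseBracket (ε⁻¹ • (y - x)) ^ (-5 : ℝ))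
        ≤ ε⁻¹ ^ 3 * (3 * (((1 + ε) * japaneseBracket x) ^ (5 : ℝ) *
            japaneseBracket y ^ (-5 : ℝ))) := by
          gcongr
          exact scaled_japaneseBracket_rpow_le hε (by norm_num) x y
      _ = B5 * japaneseBracket y ^ (-5 : ℝ) := by ring
      _ ≤ _ := mul_le_mul_of_nonneg_right (by linarith) (japaneseBracket_rpow_pos y _).le

theorem mollifier_le {ε : ℝ} (hε : 0 < ε) (x y : R3) :
    mollifier ε x y ≤ (ε⁻¹ ^ 3 * 3 * (1 + ε) ^ (5 : ℝ)) *
      (japaneseBracket x ^ (5 : ℝ) * japaneseBracket y ^ (-5 : ℝ)) := by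
  have h := scaled_japaneseBracket_rpow_le hε (t := 5) (by norm_num) x y
  rw [Real.mul_rpow (by positivity) (japaneseBracket_pos x).le] at h
  calc mollifier ε x y ≤ ε⁻¹ ^ 3 * (3 * ((1 + ε) ^ (5 : ℝ) * japaneseBracket x ^ (5 : ℝ) *
        japaneseBracket y ^ (-5 : ℝ))) := by
        rw [mollifier]
        gcongr
    _ = _ := by ring

theorem MemWeightedL2.integrable_mollifier_smul {f : R3 → Spinor}
    (hf : MemWeightedL2 (-3 / 2) f) {ε : ℝ} (hε : 0 < ε) (x : R3) :
    Integrable fun y => ((mollifier ε x y : ℝ) : ℂ) • f y := by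
  refine hf.integrable_smul (t := 5)
    (B := (ε⁻¹ ^ 3 * 3 * (1 + ε) ^ (5 : ℝ)) * japaneseBracket x ^ (5 : ℝ)) ?_ ?_ (by norm_num)
  · exact (Complex.continuous_ofReal.comp ((continuous_mollifier ε).comp
      (Continuous.prodMk_right x))).aestronglyMeasurable
  · intro y
    rw [Complex.norm_real, Real.norm_of_nonneg (mollifier_pos hε x y).le, mul_assoc]
    exact mollifier_le hε x y

/-- Regularizations of a weak solution are dominated by the Riesz potential of the source. -/
theorem IsWeakDirac.enorm_integral_mollifier_le {t : ℝ} {f g : R3 → Spinor} (h : IsWeakDirac f g)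
    (hf : MemWeightedL2 (-3 / 2) f) (ht : -1 / 2 < t) (hg : MemWeightedL2 t g) {ε : ℝ}
    (hε : 0 < ε) (x : R3) :
    ‖∫ y, ((mollifier ε x y : ℝ) : ℂ) • f y‖ₑ ≤ 24 * rieszPotential (fun y => ‖g y‖ₑ) x := by
  have h1 := h.integral_mollifier_eq hf ht hg hε x
  have hi1 := hf.integrable_mollifier_smul hε x
  have hi2 : Integrable fun y => ∑ k, ((ε⁻¹ ^ 2 * bracketField k (ε⁻¹ • (y - x)) : ℝ) : ℂ) •
          matAct (diracAlpha k) (g y) := by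
    refine integrable_finsetSum _ fun k _ => (hg.matAct _).integrable_smul (t := 2)
      (B := ε⁻¹ ^ 2 * ((1 + ε) * japaneseBracket x) ^ (2 : ℝ)) ?_ (fun y => ?_) (by linarith)
    · exact (Complex.continuous_ofReal.comp (continuous_const.mul
        ((contDiff_bracketField k).continuous.comp (by fun_prop)))).aestronglyMeasurable
    · rw [Complex.norm_real, norm_mul, Real.norm_of_nonneg (by positivity), mul_assoc]
      refine mul_le_mul_of_nonneg_left ?_ (by positivity)
      exact (abs_bracketField_le_rpow k _).trans
        (scaled_japaneseBracket_rpow_le hε zero_le_two x y)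
  simp_rw [mul_smul] at h1
  rw [integral_add (f := fun y => Complex.I • ((mollifier ε x y : ℝ) : ℂ) • f y)
    (hi1.smul Complex.I) hi2, integral_smul] at h1
  have h3 := eq_neg_of_add_eq_zero_left h1
  have h4 : ‖∫ y, ((mollifier ε x y : ℝ) : ℂ) • f y‖ₑ =
      ‖∫ y, ∑ k, ((ε⁻¹ ^ 2 * bracketField k (ε⁻¹ • (y - x)) : ℝ) : ℂ) •
          matAct (diracAlpha k) (g y)‖ₑ := by
    have h5 := congrArg (fun v => ‖v‖ₑ) h3
    simp only [enorm_neg, enorm_smul] at h5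
    rw [← h5, ← ofReal_norm Complex.I]
    simp
  rw [h4, rieszPotential, ← lintegral_const_mul' _ _ (by simp)]
  refine (enorm_integral_le_lintegral_enorm _).trans (lintegral_mono fun y => ?_)
  have hk : ∀ k, ‖((ε⁻¹ ^ 2 * bracketField k (ε⁻¹ • (y - x)) : ℝ) : ℂ) •
          matAct (diracAlpha k) (g y)‖ ≤ (‖x - y‖ ^ 2)⁻¹ * (8 * ‖g y‖) := fun k => by
    rw [norm_smul, Complex.norm_real]
    refine mul_le_mul ?_ (norm_diracAlpha_le k _) (norm_nonneg _) (by positivity)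
    rw [norm_mul, Real.norm_of_nonneg (by positivity)]
    -- Homogeneity of degree `-2` cancels `ε`, making the final estimate uniform in the scale.
    calc ε⁻¹ ^ 2 * ‖bracketField k (ε⁻¹ • (y - x))‖ ≤ ε⁻¹ ^ 2 * (‖ε⁻¹ • (y - x)‖ ^ 2)⁻¹ := by
          gcongr
          exact abs_bracketField_le_inv_sq k _
      _ = (‖x - y‖ ^ 2)⁻¹ := by
          rw [norm_smul, norm_inv, Real.norm_of_nonneg hε.le, norm_sub_rev, mul_pow, mul_inv]
          field_simp
  have hs := (norm_sum_le Finset.univ fun k => ((ε⁻¹ ^ 2 * bracketField k (ε⁻¹ • (y - x)) : ℝ) : ℂ) •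
          matAct (diracAlpha k) (g y)).trans (Finset.sum_le_sum fun k _ => hk k)
  have h24 : (24 : ENNReal) = ENNReal.ofReal 24 := by simp
  rw [rieszKernel, ← ofReal_norm, ← ofReal_norm, ← ENNReal.ofReal_mul (by positivity), h24, ← ENNReal.ofReal_mul (by positivity)]
  refine ENNReal.ofReal_le_ofReal (hs.trans (le_of_eq ?_))
  simp
  ring

/-! ### Passing to the limit in the regularization -/

/-- The total mass of the mollifiers. -/
def mollifierMass : ℝ := ∫ z : R3, 3 * japaneseBracket z ^ (-5 : ℝ)

theorem integrable_japaneseBracket_rpow_neg_five :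
    Integrable fun z : R3 => 3 * japaneseBracket z ^ (-5 : ℝ) := by
  have h := integrable_rpow_neg_one_add_norm_sq (E := R3) (μ := volume) (r := 5)
    (by simp; norm_num)
  refine (h.congr (.of_forall fun x => ?_)).const_mul 3
  simp only
  rw [japaneseBracket_rpow]

/-- Only positivity of the mass is needed, to divide by it after the limit. -/
theorem mollifierMass_pos : 0 < mollifierMass := by
  refine integral_pos_of_integrable_nonneg_nonzero (x := 0)
    (continuous_const.mul (continuous_japaneseBracket_rpow _))
    integrable_japaneseBracket_rpow_neg_five (fun z => ?_) ?_
  · exact (mul_pos three_pos (japaneseBracket_rpow_pos z _)).le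
  · exact (mul_pos three_pos (japaneseBracket_rpow_pos _ _)).ne'

/-- The substitution `x = y - ε z` moves the scale from the kernel into the test function. -/
theorem integral_mul_mollifier {ε : ℝ} (hε : 0 < ε) (ψ : R3 → ℝ) (y : R3) :
    ∫ x, ψ x * mollifier ε x y = ∫ z, ψ (y - ε • z) * (3 * japaneseBracket z ^ (-5 : ℝ)) := by
  set F : R3 → ℝ := fun z => ψ (y - ε • z) * (3 * japaneseBracket z ^ (-5 : ℝ)) with hF
  have h1 : ∀ x, ψ x * mollifier ε x y = ε⁻¹ ^ 3 * F (ε⁻¹ • (y - x)) := fun x => by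
    simp only [hF, mollifier, smul_smul, mul_inv_cancel₀ hε.ne', one_smul, sub_sub_cancel]
    ring
  simp_rw [h1]
  rw [integral_const_mul, integral_sub_left_eq_self (fun w => F (ε⁻¹ • w)) volume y,
    Measure.integral_comp_inv_smul_of_nonneg volume F hε.le]
  simp
  field_simp

theorem tendsto_integral_mul_mollifier {ψ : R3 → ℝ} (hψ : Continuous ψ)
    (hψs : HasCompactSupport ψ) (y : R3) {ε : ℕ → ℝ} (hε : ∀ n, 0 < ε n)
    (hε0 : Tendsto ε atTop (𝓝 0)) :
    Tendsto (fun n => ∫ x, ψ x * mollifier (ε n) x y) atTop (𝓝 (mollifierMass * ψ y)) := by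
  simp_rw [integral_mul_mollifier (hε _)]
  obtain ⟨A, hA⟩ := hψs.exists_bound_of_continuous hψ
  rw [mollifierMass, mul_comm, ← integral_const_mul]
  refine tendsto_integral_of_dominated_convergence
    (fun z => A * (3 * japaneseBracket z ^ (-5 : ℝ)))
    (fun n => ?_) (integrable_japaneseBracket_rpow_neg_five.const_mul A)
    (fun n => .of_forall fun z => ?_) (.of_forall fun z => ?_)
  · exact ((hψ.comp (by fun_prop)).mul (continuous_const.mul
      (continuous_japaneseBracket_rpow _))).aestronglyMeasurable
  · have h3 := mul_pos three_pos (japaneseBracket_rpow_pos z (-5))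
    rw [norm_mul, Real.norm_of_nonneg h3.le]
    exact mul_le_mul_of_nonneg_right (hA _) h3.le
  · refine Tendsto.mul_const _ ((hψ.tendsto y).comp ?_)
    have h := (hε0.smul_const z).const_sub y
    simpa using h

/-- Supplies a majorant uniform in `ε ≤ 1`: `⟨y⟩⁻⁴` is integrable against `f` because `-3/2 + 4 >
3/2`. For `y` near the support the average is at most `sup |ψ|` times the mass. Far away, `|y - x| ≥
⟨y⟩/2` on the support, so the mollifier is at most `3 · 2⁵ ε² ⟨y⟩⁻⁵`. -/
theorem exists_integral_mul_mollifier_le {ψ : R3 → ℝ} (hψ : Continuous ψ)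
    (hψs : HasCompactSupport ψ) (hψ0 : ∀ x, 0 ≤ ψ x) :
    ∃ K, ∀ ε : ℝ, 0 < ε → ε ≤ 1 → ∀ y,
      ‖∫ x, ψ x * mollifier ε x y‖ ≤ K * japaneseBracket y ^ (-4 : ℝ) := by
  obtain ⟨A, hA⟩ := hψs.exists_bound_of_continuous hψ
  obtain ⟨r, hr⟩ := hψs.isCompact.isBounded.exists_norm_le
  have hψi : Integrable ψ := hψ.integrable_of_hasCompactSupport hψs
  set r1 := 1 + |r| with hr1
  have hA0 : 0 ≤ A := (norm_nonneg _).trans (hA 0)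
  have hI0 : 0 ≤ ∫ x, ψ x := integral_nonneg hψ0
  have hm0 := mollifierMass_pos
  have hsupp : ∀ x, ψ x ≠ 0 → japaneseBracket x ≤ r1 := fun x hx => by
    have h1 := hr x (subset_tsupport ψ hx)
    have h2 := japaneseBracket_le_one_add_norm x
    have h3 := le_abs_self r
    linarith
  refine ⟨A * mollifierMass * (2 * r1) ^ (4 : ℝ) + 96 * ∫ x, ψ x, fun ε hε hε1 y => ?_⟩
  have hy := japaneseBracket_pos y
  have hy4 := japaneseBracket_rpow_pos y (-4)
  have hr1p : 0 < r1 := by positivity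
  rw [Real.norm_of_nonneg (integral_nonneg fun x => mul_nonneg (hψ0 x) (mollifier_pos hε x y).le)]
  rcases le_or_gt (japaneseBracket y) (2 * r1) with hcase | hcase
  · have h1 : ∫ x, ψ x * mollifier ε x y ≤ A * mollifierMass := by
      rw [integral_mul_mollifier hε, mollifierMass, ← integral_const_mul]
      refine integral_mono_of_nonneg (.of_forall fun z => ?_)
        (integrable_japaneseBracket_rpow_neg_five.const_mul A) (.of_forall fun z => ?_)
      · exact mul_nonneg (hψ0 _) (mul_pos three_pos (japaneseBracket_rpow_pos z _)).le
      · exact mul_le_mul_of_nonneg_right ((le_abs_self _).trans (hA _))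
          (mul_pos three_pos (japaneseBracket_rpow_pos z _)).le
    have h2 : 1 ≤ (2 * r1) ^ (4 : ℝ) * japaneseBracket y ^ (-4 : ℝ) := by
      rw [Real.rpow_neg hy.le, ← div_eq_mul_inv, one_le_div (by positivity)]
      exact Real.rpow_le_rpow hy.le hcase (by norm_num)
    have h3 : 0 ≤ (96 * ∫ x, ψ x) * japaneseBracket y ^ (-4 : ℝ) := by positivity
    calc ∫ x, ψ x * mollifier ε x y ≤ A * mollifierMass * 1 := by simpa using h1
      _ ≤ A * mollifierMass * ((2 * r1) ^ (4 : ℝ) * japaneseBracket y ^ (-4 : ℝ)) := by gcongr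
      _ ≤ _ := by linarith
  · have hpt : ∀ x, ψ x * mollifier ε x y ≤ ψ x * (96 * japaneseBracket y ^ (-4 : ℝ)) := fun x => by
      by_cases hx : ψ x = 0
      · simp [hx]
      refine mul_le_mul_of_nonneg_left ?_ (hψ0 x)
      have h1 := hsupp x hx
      have h2 := japaneseBracket_le_add y x
      have h3 : ε⁻¹ * (japaneseBracket y / 2) ≤ japaneseBracket (ε⁻¹ • (y - x)) := by
        refine le_trans ?_ (norm_le_japaneseBracket _)
        rw [norm_smul, norm_inv, Real.norm_of_nonneg hε.le]
        gcongr
        linarith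
      have h4 : japaneseBracket (ε⁻¹ • (y - x)) ^ (-5 : ℝ) ≤
          (ε⁻¹ * (japaneseBracket y / 2)) ^ (-5 : ℝ) :=
        Real.rpow_le_rpow_of_nonpos (by positivity) h3 (by norm_num)
      have h5 : (ε⁻¹ * (japaneseBracket y / 2)) ^ (-5 : ℝ) =
          32 * ε ^ 5 * japaneseBracket y ^ (-5 : ℝ) := by
        rw [Real.rpow_neg (by positivity), Real.rpow_neg hy.le]
        norm_cast
        field_simp
        norm_num
      have h6 : japaneseBracket y ^ (-5 : ℝ) ≤ japaneseBracket y ^ (-4 : ℝ) :=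
        japaneseBracket_rpow_mono y (by norm_num)
      calc mollifier ε x y ≤ ε⁻¹ ^ 3 * (3 * (32 * ε ^ 5 * japaneseBracket y ^ (-5 : ℝ))) := by
            rw [mollifier, ← h5]
            gcongr
        _ = 96 * ε ^ 2 * japaneseBracket y ^ (-5 : ℝ) := by
            field_simp
            norm_num
        _ ≤ 96 * 1 * japaneseBracket y ^ (-4 : ℝ) := by
            gcongr
            nlinarith
        _ = _ := by ring
    have h1 : ∫ x, ψ x * mollifier ε x y ≤ ∫ x, ψ x * (96 * japaneseBracket y ^ (-4 : ℝ)) :=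
      integral_mono_of_nonneg
        (.of_forall fun x => mul_nonneg (hψ0 x) (mollifier_pos hε x y).le)
        (hψi.mul_const _) (.of_forall hpt)
    rw [integral_mul_const] at h1
    have h3 : 0 ≤ (A * mollifierMass * (2 * r1) ^ (4 : ℝ)) * japaneseBracket y ^ (-4 : ℝ) := by
      positivity
    linarith

theorem integral_smul_mollifier_swap {f : R3 → Spinor} (hf : MemWeightedL2 (-3 / 2) f)
    {ψ : R3 → ℝ} (hψ : Continuous ψ) (hψs : HasCompactSupport ψ) {ε : ℝ} (hε : 0 < ε) :
    ∫ x, (ψ x : ℂ) • ∫ y, ((mollifier ε x y : ℝ) : ℂ) • f y =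
      ∫ y, ((∫ x, ψ x * mollifier ε x y : ℝ) : ℂ) • f y := by
  have h5 : Integrable fun y => (((japaneseBracket y ^ (-5 : ℝ) : ℝ)) : ℂ) • f y :=
    hf.integrable_smul (t := 5) (B := 1)
      (Complex.continuous_ofReal.comp (continuous_japaneseBracket_rpow _)).aestronglyMeasurable
      (fun y => by
        rw [Complex.norm_real, Real.norm_of_nonneg (japaneseBracket_rpow_pos _ _).le, one_mul])
      (by norm_num)
  have hψi : Integrable fun x => japaneseBracket x ^ (5 : ℝ) * ψ x :=
    ((continuous_japaneseBracket_rpow _).mul hψ).integrable_of_hasCompactSupport hψs.mul_left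
  have hprod : Integrable (Function.uncurry fun x y =>
      (ψ x : ℂ) • ((mollifier ε x y : ℝ) : ℂ) • f y) (volume.prod volume) := by
    -- Fubini applies because `mollifier_le` gives a product majorant, `⟨x⟩⁵ |ψ(x)|` times `⟨y⟩⁻⁵
    -- |f(y)|`.
    have h1 := (hψi.norm.mul_prod h5.norm).const_mul (ε⁻¹ ^ 3 * 3 * (1 + ε) ^ (5 : ℝ))
    refine h1.mono' ?_ (.of_forall fun p => ?_)
    · exact (Complex.continuous_ofReal.comp (hψ.comp continuous_fst)).aestronglyMeasurable.smul
        ((Complex.continuous_ofReal.comp (continuous_mollifier ε)).aestronglyMeasurable.smul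
          hf.aestronglyMeasurable.comp_snd)
    · obtain ⟨x, y⟩ := p
      have hm := mollifier_le hε x y
      simp only [Function.uncurry_apply_pair, norm_smul, Complex.norm_real, norm_mul,
        Real.norm_of_nonneg (mollifier_pos hε x y).le,
        Real.norm_of_nonneg (japaneseBracket_rpow_pos _ _).le]
      calc ‖ψ x‖ * (mollifier ε x y * ‖f y‖)
          ≤ ‖ψ x‖ * ((ε⁻¹ ^ 3 * 3 * (1 + ε) ^ (5 : ℝ)) *
            (japaneseBracket x ^ (5 : ℝ) * japaneseBracket y ^ (-5 : ℝ)) * ‖f y‖) := by gcongr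
        _ = _ := by ring
  simp_rw [← integral_smul]
  rw [integral_integral_swap hprod]
  refine integral_congr_ae (.of_forall fun y => ?_)
  simp only [smul_smul]
  rw [integral_smul_const]
  congr 1
  rw [← integral_complex_ofReal]
  simp

/-- Averages of a weak solution are dominated by the Riesz potential of the source. -/
theorem IsWeakDirac.enorm_integral_smul_le {t : ℝ} {f g : R3 → Spinor} (h : IsWeakDirac f g)
    (hf : MemWeightedL2 (-3 / 2) f) (ht : -1 / 2 < t) (hg : MemWeightedL2 t g)
    {ψ : R3 → ℝ} (hψ : Continuous ψ) (hψs : HasCompactSupport ψ) (hψ0 : ∀ x, 0 ≤ ψ x) :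
    ‖mollifierMass • ∫ y, ψ y • f y‖ₑ ≤
      ∫⁻ x, ENNReal.ofReal (ψ x) * (24 * rieszPotential (fun y => ‖g y‖ₑ) x) := by
  set ε : ℕ → ℝ := fun n => 1 / ((n : ℝ) + 1) with hεdef
  have hε : ∀ n, 0 < ε n := fun n => Nat.one_div_pos_of_nat
  have hε0 : Tendsto ε atTop (𝓝 0) := tendsto_one_div_add_atTop_nhds_zero_nat
  have hε1 : ∀ n, ε n ≤ 1 := fun n => by
    rw [hεdef]
    exact div_le_one_of_le₀ (by simp) (by positivity)
  obtain ⟨K, hK⟩ := exists_integral_mul_mollifier_le hψ hψs hψ0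
  have hmeas : ∀ n, Measurable fun y => ∫ x, ψ x * mollifier (ε n) x y := fun n => by
    refine (StronglyMeasurable.integral_prod_left' (μ := volume)
      (f := fun p : R3 × R3 => ψ p.1 * mollifier (ε n) p.1 p.2) ?_).measurable
    exact ((hψ.comp continuous_fst).mul (continuous_mollifier _)).stronglyMeasurable
  have hKi : Integrable fun y => ((K * japaneseBracket y ^ (-4 : ℝ) : ℝ) : ℂ) • f y :=
    hf.integrable_smul (t := 4) (B := |K|)
      (Complex.continuous_ofReal.comp (continuous_const.mul
        (continuous_japaneseBracket_rpow _))).aestronglyMeasurable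
      (fun y => by
        rw [Complex.norm_real, norm_mul, Real.norm_of_nonneg (japaneseBracket_rpow_pos _ _).le,
          Real.norm_eq_abs]) (by norm_num)
  have hlim : Tendsto (fun n => ∫ y, ((∫ x, ψ x * mollifier (ε n) x y : ℝ) : ℂ) • f y) atTop
      (𝓝 (∫ y, ((mollifierMass * ψ y : ℝ) : ℂ) • f y)) := by
    refine tendsto_integral_of_dominated_convergence _ (fun n => ?_) hKi.norm
      (fun n => .of_forall fun y => ?_) (.of_forall fun y => ?_)
    · exact (Complex.continuous_ofReal.measurable.comp (hmeas n)).aestronglyMeasurable.smul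
        hf.aestronglyMeasurable
    · rw [norm_smul, norm_smul, Complex.norm_real, Complex.norm_real]
      exact mul_le_mul_of_nonneg_right ((hK _ (hε n) (hε1 n) y).trans (le_abs_self _))
        (norm_nonneg _)
    · exact ((Complex.continuous_ofReal.tendsto _).comp
        (tendsto_integral_mul_mollifier hψ hψs y hε hε0)).smul_const _
  have heq : ∫ y, ((mollifierMass * ψ y : ℝ) : ℂ) • f y = mollifierMass • ∫ y, ψ y • f y := by
    rw [← integral_smul]
    refine integral_congr_ae (.of_forall fun y => ?_)
    simp only [smul_smul]
    exact Complex.coe_smul _ _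
  rw [heq] at hlim
  -- The right-hand side does not depend on `n`, so it suffices to prove the bound at each scale.
  refine le_of_tendsto hlim.enorm (.of_forall fun n => ?_)
  rw [← integral_smul_mollifier_swap hf hψ hψs (hε n)]
  refine (enorm_integral_le_lintegral_enorm _).trans (lintegral_mono fun x => ?_)
  rw [enorm_smul]
  refine mul_le_mul' (le_of_eq ?_) (h.enorm_integral_mollifier_le hf ht hg (hε n) x)
  rw [← ofReal_norm, Complex.norm_real, Real.norm_of_nonneg (hψ0 x)]

/-! ### From averages to pointwise bounds -/

theorem locallyIntegrable_of_memLp_weighted {F : Type*} [NormedAddCommGroup F] [NormedSpace ℝ F]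
    {s : ℝ} {h : R3 → F} (hh : MemLp (fun x => japaneseBracket x ^ s • h x) 2 volume) :
    LocallyIntegrable h := by
  have h1 := hh.locallyIntegrable one_le_two
  rw [locallyIntegrable_iff] at h1 ⊢
  intro k hk
  refine ((h1 k hk).continuousOn_smul
    (continuous_japaneseBracket_rpow (-s)).continuousOn hk).congr (.of_forall fun x => ?_)
  simp only [smul_smul]
  rw [← Real.rpow_add (japaneseBracket_pos x)]
  simp

/-- Comparison of averages gives pointwise comparison almost everywhere. -/
theorem ae_norm_le_of_integral_smul_le {f : R3 → Spinor} {H : R3 → ℝ} (hf : LocallyIntegrable f)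
    (hH : LocallyIntegrable H)
    (h : ∀ ψ : R3 → ℝ, Continuous ψ → HasCompactSupport ψ → (∀ x, 0 ≤ ψ x) →
      ‖∫ y, ψ y • f y‖ ≤ ∫ y, ψ y * H y) : ∀ᵐ x, ‖f x‖ ≤ H x := by
  let φ : ℕ → ContDiffBump (0 : R3) := fun n =>
    ⟨1 / ((n : ℝ) + 1), 2 * (1 / ((n : ℝ) + 1)), Nat.one_div_pos_of_nat, by
      have : (0 : ℝ) < 1 / ((n : ℝ) + 1) := Nat.one_div_pos_of_nat
      linarith⟩
  have hφ : Tendsto (fun n => (φ n).rOut) atTop (𝓝 0) := by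
    have := (tendsto_one_div_add_atTop_nhds_zero_nat (𝕜 := ℝ)).const_mul 2
    rwa [mul_zero] at this
  -- Comparable inner and outer radii are what Lebesgue differentiation along these bumps requires.
  have hφ' : ∀ᶠ n in atTop, (φ n).rOut ≤ 2 * (φ n).rIn := .of_forall fun n => le_rfl
  filter_upwards [ContDiffBump.ae_convolution_tendsto_right_of_locallyIntegrable hφ hφ' hf,
    ContDiffBump.ae_convolution_tendsto_right_of_locallyIntegrable hφ hφ' hH]
    with x hx1 hx2
  refine le_of_tendsto_of_tendsto hx1.norm hx2 (.of_forall fun n => ?_)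
  simp only [convolution_eq_swap, ContinuousLinearMap.lsmul_apply, smul_eq_mul]
  refine h (fun y => (φ n).normed volume (x - y)) ?_ ?_ fun y => (φ n).nonneg_normed _
  · exact (φ n).continuous_normed.comp (by fun_prop)
  · exact (φ n).hasCompactSupport_normed.comp_homeomorph (Homeomorph.subLeft x)

/-- Weak solutions of critical growth gain one power of decay over their source. -/
theorem IsWeakDirac.memWeightedL2 {s : ℝ} {f g : R3 → Spinor} (h : IsWeakDirac f g)
    (hf : MemWeightedL2 (-3 / 2) f) (hs1 : -1 / 2 < s) (hs2 : s < 3 / 2)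
    (hg : MemWeightedL2 s g) : MemWeightedL2 (s - 1) f := by
  obtain ⟨C, hC, hT⟩ := exists_lintegral_rieszPotential_le hs1 hs2
  set T := rieszPotential (fun y => ‖g y‖ₑ) with hTdef
  have hgm : AEMeasurable fun y => ‖g y‖ₑ := hg.aestronglyMeasurable.enorm
  have hTm : Measurable T := measurable_rieszPotential hgm
  have hT2 : ∫⁻ x, bracketWeight (2 * (s - 1)) x * T x ^ 2 < ⊤ := by
    refine (hT _ hgm).trans_lt (ENNReal.mul_lt_top hC.lt_top ?_)
    exact (memWeightedL2_iff hg.aestronglyMeasurable).1 hg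
  -- Finiteness almost everywhere is needed before passing to real values, since `toReal` sends `⊤`
  -- to 0.
  have hTfin : ∀ᵐ x, T x < ⊤ := by
    filter_upwards [ae_lt_top ((measurable_bracketWeight _).mul (hTm.pow_const 2)) hT2.ne] with x hx
    by_contra hcon
    rw [not_lt_top_iff] at hcon
    simp only [Pi.mul_apply, hcon] at hx
    have : bracketWeight (2 * (s - 1)) x ≠ 0 := by
      simpa [bracketWeight] using japaneseBracket_rpow_pos x _
    simp [this] at hx
  have hHw : MemLp (fun x => japaneseBracket x ^ (s - 1) • (T x).toReal) 2 volume := by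
    have hm : AEStronglyMeasurable (fun x => japaneseBracket x ^ (s - 1) • (T x).toReal) volume :=
      (continuous_japaneseBracket_rpow _).aestronglyMeasurable.smul
        hTm.ennreal_toReal.aestronglyMeasurable
    refine ⟨hm, ?_⟩
    rw [eLpNorm_lt_top_iff_lintegral_rpow_enorm_lt_top (by simp) (by simp)]
    refine lt_of_le_of_lt (lintegral_mono fun x => ?_) hT2
    have hj := japaneseBracket_rpow_pos x (s - 1)
    rw [enorm_smul, Real.enorm_eq_ofReal hj.le, Real.enorm_eq_ofReal ENNReal.toReal_nonneg,
      ENNReal.toReal_ofNat, ENNReal.rpow_two, mul_pow]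
    refine mul_le_mul' (le_of_eq ?_) (pow_le_pow_left' ENNReal.ofReal_toReal_le 2)
    change bracketWeight (s - 1) x ^ 2 = _
    rw [sq, bracketWeight_mul]
    ring_nf
  have hHl : LocallyIntegrable fun x => (T x).toReal := locallyIntegrable_of_memLp_weighted hHw
  have hm0 := mollifierMass_pos
  have hae : ∀ᵐ x, ‖f x‖ ≤ mollifierMass⁻¹ * 24 * (T x).toReal := by
    refine ae_norm_le_of_integral_smul_le (locallyIntegrable_of_memLp_weighted hf)
      (hHl.smul (mollifierMass⁻¹ * 24)) fun ψ hψ hψs hψ0 => ?_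
    have h1 := h.enorm_integral_smul_le hf hs1 hg hψ hψs hψ0
    have hi : Integrable fun x => ψ x * (24 * (T x).toReal) :=
      (hHl.smul (24 : ℝ)).integrable_smul_left_of_hasCompactSupport hψ hψs
    have h2 : ∫⁻ x, ENNReal.ofReal (ψ x) * (24 * T x) =
        ENNReal.ofReal (∫ x, ψ x * (24 * (T x).toReal)) := by
      rw [ofReal_integral_eq_lintegral_ofReal hi (.of_forall fun x =>
        mul_nonneg (hψ0 x) (by positivity))]
      refine lintegral_congr_ae ?_
      filter_upwards [hTfin] with x hx
      rw [ENNReal.ofReal_mul (hψ0 x), ENNReal.ofReal_mul (by norm_num),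
        ENNReal.ofReal_toReal hx.ne]
      simp
    rw [← hTdef, h2, ← ofReal_norm, ENNReal.ofReal_le_ofReal_iff (integral_nonneg fun x =>
      mul_nonneg (hψ0 x) (by positivity)), norm_smul, Real.norm_of_nonneg hm0.le] at h1
    calc ‖∫ y, ψ y • f y‖ ≤ mollifierMass⁻¹ * ∫ x, ψ x * (24 * (T x).toReal) := by
          rw [← div_eq_inv_mul, le_div_iff₀ hm0]
          linarith
      _ = ∫ y, ψ y * (mollifierMass⁻¹ * 24 * (T y).toReal) := by
          rw [← integral_const_mul]
          refine integral_congr_ae (.of_forall fun y => ?_)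
          simp only
          ring
  refine hHw.of_le_mul (c := mollifierMass⁻¹ * 24)
    ((continuous_japaneseBracket_rpow _).aestronglyMeasurable.smul hf.aestronglyMeasurable) ?_
  filter_upwards [hae] with x hx
  have hj := japaneseBracket_rpow_pos x (s - 1)
  rw [weighted, norm_smul, norm_smul, Real.norm_of_nonneg hj.le,
    Real.norm_of_nonneg ENNReal.toReal_nonneg]
  calc japaneseBracket x ^ (s - 1) * ‖f x‖
      ≤ japaneseBracket x ^ (s - 1) * (mollifierMass⁻¹ * 24 * (T x).toReal) := by gcongr
    _ = _ := by ring

/-! ### Elliptic regularity in `L²` -/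

open TemperedDistribution LineDeriv Laplacian FourierTransform in
-- The Fourier transform is normalized with `2π` in the exponent, so the symbol `1 + |ξ|²`
-- corresponds to `1 - (2π)⁻² Δ`.
theorem besselPotential_two_eq (u : 𝓢'(R3, Spinor)) :
    besselPotential R3 Spinor 2 u = u - ((((2 * Real.pi) ^ 2)⁻¹ : ℝ) : ℂ) • Δ u := by
  have hg : (fun x : R3 => (Complex.ofReal (‖x‖ ^ 2))).HasTemperateGrowth := by fun_prop
  have h1 : (fun x : R3 => (((1 + ‖x‖ ^ 2) ^ ((2 : ℝ) / 2) : ℝ) : ℂ)) =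
      (fun _ => (1 : ℂ)) + fun x => Complex.ofReal (‖x‖ ^ 2) := by
    ext x
    simp
  have hpi : (2 * Real.pi) ^ 2 ≠ 0 := by positivity
  have h2 : fourierMultiplierCLM Spinor (fun x : R3 => Complex.ofReal (‖x‖ ^ 2)) u =
      -(((2 * Real.pi) ^ 2)⁻¹ • Δ u) := by
    rw [laplacian_eq_fourierMultiplierCLM, smul_smul, mul_neg, inv_mul_cancel₀ hpi, neg_one_smul,
      neg_neg]
  have h3 : besselPotential R3 Spinor 2 u = u +
      fourierMultiplierCLM Spinor (fun x : R3 => Complex.ofReal (‖x‖ ^ 2)) u := by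
    rw [besselPotential, h1, fourierMultiplierCLM_apply, smulLeftCLM_add (by fun_prop) hg,
      fourierMultiplierCLM_apply]
    simp [fourierInv_add]
  have hc : ∀ (c : ℝ) (T : 𝓢'(R3, Spinor)), (c : ℂ) • T = c • T := fun c T => by
    ext1 φ
    exact Complex.coe_smul c (T φ)
  rw [h3, h2, sub_eq_add_neg, hc]

theorem SchwartzMap.integrable_smul_of_memLp {u : R3 → Spinor} (hu : MemLp u 2 volume)
    (φ : 𝓢(R3, ℂ)) : Integrable fun x => φ x • u x :=
  memLp_one_iff_integrable.1 (MemLp.smul (r := 1) hu (φ.memLp 2 volume))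

theorem MemLp.matAct {u : R3 → Spinor} (hu : MemLp u 2 volume) (A : Matrix (Fin 4) (Fin 4) ℂ) :
    MemLp (fun x => matAct A (u x)) 2 volume :=
  (matCLM A).comp_memLp' hu

open LineDeriv in
/-- For square integrable data, the weak Dirac equation may be tested with Schwartz functions. -/
theorem IsWeakDirac.integral_schwartz_eq {u h : R3 → Spinor} (hw : IsWeakDirac u h)
    (hu : MemLp u 2 volume) (hh : MemLp h 2 volume) (φ : 𝓢(R3, ℂ)) :
    ∫ x, ((∑ j : Fin 3, (Complex.I * (∂_{(EuclideanSpace.single j 1 : R3)} φ) x) •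
      matAct (diracAlpha j) (u x)) + φ x • h x) = 0 := by
  obtain ⟨M, hM, hcut⟩ := exists_cutoff
  choose! χ hχ hχs hχ01 hχ1 hχM hχ0 using hcut
  set r : ℕ → ℝ := fun n => n + 1 with hr
  have hrpos : ∀ n, 0 < r n := fun n => by positivity
  set P : R3 → Spinor := fun x => (∑ j : Fin 3, (Complex.I *
    (∂_{(EuclideanSpace.single j 1 : R3)} φ) x) • matAct (diracAlpha j) (u x)) + φ x • h x with hP
  have hPi : Integrable P := by
    refine Integrable.add (integrable_finsetSum _ fun j _ => ?_) (φ.integrable_smul_of_memLp hh)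
    simp_rw [mul_smul]
    exact (SchwartzMap.integrable_smul_of_memLp (MemLp.matAct hu _) _).smul Complex.I
  set E : ℕ → R3 → Spinor := fun n x => ∑ j : Fin 3, (Complex.I * (φ x *
    fderiv ℝ (χ (r n)) x (EuclideanSpace.single j 1))) • matAct (diracAlpha j) (u x) with hE
  have hzero : ∀ n, ∫ x, (((χ (r n) x : ℝ) : ℂ) • P x + E n x) = 0 := fun n => by
    set ψ : R3 → ℂ := fun x => ((χ (r n) x : ℝ) : ℂ) * φ x with hψdef
    have hχc : ContDiff ℝ ∞ fun x => ((χ (r n) x : ℝ) : ℂ) :=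
      Complex.ofRealCLM.contDiff.comp (hχ _ (hrpos n))
    have hψ : ContDiff ℝ ∞ ψ := hχc.mul (φ.smooth ⊤)
    have hψs : HasCompactSupport ψ :=
      ((hχs _ (hrpos n)).comp_left (g := Complex.ofReal) Complex.ofReal_zero).mul_right
    rw [← hw ψ hψ hψs]
    refine integral_congr_ae (.of_forall fun x => ?_)
    have hd : ∀ v, fderiv ℝ ψ x v = ((χ (r n) x : ℝ) : ℂ) * fderiv ℝ φ x v +
        φ x * fderiv ℝ (χ (r n)) x v := fun v => by
      have h1 : HasFDerivAt (fun x => ((χ (r n) x : ℝ) : ℂ))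
          (Complex.ofRealCLM.comp (fderiv ℝ (χ (r n)) x)) x :=
        (Complex.ofRealCLM.hasFDerivAt (x := χ (r n) x)).comp x
          (((hχ _ (hrpos n)).differentiable (by simp)) x).hasFDerivAt
      have h2 : fderiv ℝ ψ x = _ := (h1.mul (φ.hasFDerivAt x)).fderiv
      rw [h2]
      simp
    simp only [hP, hE, hd, smul_add, Finset.smul_sum, SchwartzMap.lineDerivOp_apply_eq_fderiv]
    rw [add_right_comm, ← Finset.sum_add_distrib, smul_smul]
    congr 1
    refine Finset.sum_congr rfl fun j _ => ?_
    rw [smul_smul, ← add_smul]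
    congr 1
    ring
  have hχ' : ∀ n x j, ‖fderiv ℝ (χ (r n)) x (EuclideanSpace.single j 1)‖ ≤ M / r n := fun n x j => by
    have := ((fderiv ℝ (χ (r n)) x).le_opNorm (EuclideanSpace.single j 1))
    simp only [PiLp.norm_single, norm_one, mul_one] at this
    exact this.trans (hχM _ (hrpos n) x)
  have hlim : Tendsto (fun n => ∫ x, (((χ (r n) x : ℝ) : ℂ) • P x + E n x)) atTop
      (𝓝 (∫ x, P x)) := by
    refine tendsto_integral_of_dominated_convergence
      (fun x => ‖P x‖ + ∑ j : Fin 3, M * ‖φ x • matAct (diracAlpha j) (u x)‖) (fun n => ?_)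
      (hPi.norm.add (integrable_finsetSum _ fun j _ =>
        (φ.integrable_smul_of_memLp (MemLp.matAct hu _)).norm.const_mul M))
      (fun n => .of_forall fun x => ?_) (.of_forall fun x => ?_)
    · refine AEStronglyMeasurable.add ((Complex.continuous_ofReal.comp
        (hχ _ (hrpos n)).continuous).aestronglyMeasurable.smul hPi.aestronglyMeasurable) ?_
      refine Finset.aestronglyMeasurable_fun_sum _ fun j _ => ?_
      refine AEStronglyMeasurable.smul (f := fun x => Complex.I * (φ x * ((fderiv ℝ (χ (r n)) x
        (EuclideanSpace.single j 1) : ℝ) : ℂ))) (Continuous.aestronglyMeasurable ?_)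
        (MemLp.matAct hu _).aestronglyMeasurable
      exact continuous_const.mul (φ.continuous.mul (Complex.continuous_ofReal.comp
        (((hχ _ (hrpos n)).continuous_fderiv (by simp)).clm_apply continuous_const)))
    · refine (norm_add_le _ _).trans (add_le_add ?_ ?_)
      · rw [norm_smul, Complex.norm_real, Real.norm_of_nonneg (hχ01 _ (hrpos n) x).1]
        exact mul_le_of_le_one_left (norm_nonneg _) (hχ01 _ (hrpos n) x).2
      · refine (norm_sum_le _ _).trans (Finset.sum_le_sum fun j _ => ?_)
        rw [norm_smul, norm_smul, norm_mul, Complex.norm_I, one_mul, norm_mul, Complex.norm_real,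
          mul_comm ‖φ x‖, mul_assoc]
        refine mul_le_mul_of_nonneg_right ((hχ' n x j).trans ?_) (by positivity)
        exact div_le_self hM (by simp [hr])
    · have h1 : Tendsto (fun n => ((χ (r n) x : ℝ) : ℂ) • P x) atTop (𝓝 (P x)) := by
        refine tendsto_const_nhds.congr' ?_
        filter_upwards [eventually_gt_atTop ⌈‖x‖⌉₊] with n hn
        have : ‖x‖ < n := Nat.lt_of_ceil_lt hn
        rw [hχ1 _ (hrpos n) x (this.trans (by simp [hr]))]
        simp
      have h2 : Tendsto (fun n => E n x) atTop (𝓝 0) := by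
        refine tendsto_const_nhds.congr' ?_
        filter_upwards [eventually_gt_atTop ⌈‖x‖⌉₊] with n hn
        have : ‖x‖ < n := Nat.lt_of_ceil_lt hn
        simp only [hE, hχ0 _ (hrpos n) x (Or.inl (this.trans (by simp [hr])))]
        simp
      simpa using h1.add h2
  simp_rw [hzero] at hlim
  exact (tendsto_nhds_unique hlim tendsto_const_nhds)

open LineDeriv in
theorem SchwartzMap.lineDerivOp_lineDerivOp_comm (φ : 𝓢(R3, ℂ)) (v w x : R3) :
    (∂_{v} (∂_{w} φ)) x = (∂_{w} (∂_{v} φ)) x := by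
  have h : ∀ v w : R3, (∂_{v} (∂_{w} φ)) x = fderiv ℝ (fderiv ℝ φ) x v w := fun v w => by
    have h1 : ⇑(∂_{w} φ : 𝓢(R3, ℂ)) = fun y => fderiv ℝ φ y w :=
      funext fun y => SchwartzMap.lineDerivOp_apply_eq_fderiv w φ y
    have h2 : DifferentiableAt ℝ (fderiv ℝ φ) x :=
      ((φ.smooth 2).fderiv_right (m := 1) (by norm_num)).differentiable (by simp) x
    rw [SchwartzMap.lineDerivOp_apply_eq_fderiv, h1, fderiv_clm_apply h2 (by fun_prop)]
    simp
  rw [h, h]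
  exact ((φ.smooth 2).contDiffAt.isSymmSndFDerivAt (by simp)) v w

open LineDeriv Laplacian in
/-- The Laplacian of a square integrable weak solution, as a tempered distribution. -/
theorem IsWeakDirac.laplacian_eq {u h : R3 → Spinor} (hw : IsWeakDirac u h)
    (hu : MemLp u 2 volume) (hh : MemLp h 2 volume) :
    Δ ((hu.toLp u : Lp Spinor 2 (volume : Measure R3)) : 𝓢'(R3, Spinor)) =
      (-Complex.I) • ∑ k : Fin 3, ∂_{(EuclideanSpace.single k 1 : R3)}
        (((MemLp.matAct hh (diracAlpha k)).toLp _ : Lp Spinor 2 (volume : Measure R3)) :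
          𝓢'(R3, Spinor)) := by
  ext1 φ
  have hLU : ∀ (v : R3 → Spinor) (hv : MemLp v 2 volume) (ψ : 𝓢(R3, ℂ)),
      ((hv.toLp v : Lp Spinor 2 (volume : Measure R3)) : 𝓢'(R3, Spinor)) ψ = ∫ x, ψ x • v x :=
    fun v hv ψ => by
      rw [Lp.toTemperedDistribution_apply]
      refine integral_congr_ae ?_
      filter_upwards [hv.coeFn_toLp] with x hx
      rw [hx]
  -- Testing with `∂ₖ φ`, applying `αₖ` and summing is the weak form of squaring the Dirac operator;
  -- symmetry of the Hessian reduces it to the Laplacian.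
  have hz : ∀ k : Fin 3, ∫ x, matCLM (diracAlpha k) ((∑ j : Fin 3, (Complex.I *
      (∂_{(EuclideanSpace.single j 1 : R3)} (∂_{(EuclideanSpace.single k 1 : R3)} φ)) x) •
      matAct (diracAlpha j) (u x)) + (∂_{(EuclideanSpace.single k 1 : R3)} φ) x • h x) = 0 :=
    fun k => by
      rw [ContinuousLinearMap.integral_comp_comm, hw.integral_schwartz_eq hu hh, map_zero]
      refine Integrable.add (integrable_finsetSum _ fun j _ => ?_)
        (SchwartzMap.integrable_smul_of_memLp hh _)
      simp_rw [mul_smul]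
      exact (SchwartzMap.integrable_smul_of_memLp (MemLp.matAct hu _) _).smul Complex.I
  have hi : ∀ k : Fin 3, Integrable fun x => matCLM (diracAlpha k) ((∑ j : Fin 3, (Complex.I *
      (∂_{(EuclideanSpace.single j 1 : R3)} (∂_{(EuclideanSpace.single k 1 : R3)} φ)) x) •
      matAct (diracAlpha j) (u x)) + (∂_{(EuclideanSpace.single k 1 : R3)} φ) x • h x) :=
    fun k => by
      refine (matCLM (diracAlpha k)).integrable_comp (Integrable.add
        (integrable_finsetSum _ fun j _ => ?_) (SchwartzMap.integrable_smul_of_memLp hh _))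
      simp_rw [mul_smul]
      exact (SchwartzMap.integrable_smul_of_memLp (MemLp.matAct hu _) _).smul Complex.I
  have hsum := integral_finsetSum Finset.univ fun k _ => hi k
  simp only [hz, Finset.sum_const_zero] at hsum
  have hΔ : ∀ x, (Δ φ) x = ∑ j : Fin 3, (∂_{(EuclideanSpace.single j 1 : R3)}
      (∂_{(EuclideanSpace.single j 1 : R3)} φ)) x := fun x => by
    rw [SchwartzMap.laplacian_eq_sum (EuclideanSpace.basisFun (Fin 3) ℝ)]
    simp
  have hpt : ∀ x, ∑ k, matCLM (diracAlpha k) ((∑ j : Fin 3, (Complex.I *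
      (∂_{(EuclideanSpace.single j 1 : R3)} (∂_{(EuclideanSpace.single k 1 : R3)} φ)) x) •
      matAct (diracAlpha j) (u x)) + (∂_{(EuclideanSpace.single k 1 : R3)} φ) x • h x) =
      Complex.I • (Δ φ) x • u x + ∑ k : Fin 3, (∂_{(EuclideanSpace.single k 1 : R3)} φ) x •
        matAct (diracAlpha k) (h x) := fun x => by
    rw [hΔ, ← sum_smul_diracAlpha_diracAlpha (fun k j => (∂_{(EuclideanSpace.single j 1 : R3)}
      (∂_{(EuclideanSpace.single k 1 : R3)} φ) : 𝓢(R3, ℂ)) x)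
      (fun _ _ => SchwartzMap.lineDerivOp_lineDerivOp_comm φ _ _ x) (u x)]
    simp only [map_add, map_sum, map_smul, matCLM_apply, Finset.sum_add_distrib, Finset.smul_sum,
      smul_smul]
  simp_rw [hpt] at hsum
  rw [integral_add (f := fun x => Complex.I • (Δ φ : 𝓢(R3, ℂ)) x • u x)
    ((SchwartzMap.integrable_smul_of_memLp hu _).smul Complex.I)
    (integrable_finsetSum _ fun k _ => SchwartzMap.integrable_smul_of_memLp (MemLp.matAct hh _) _),
    integral_smul, integral_finsetSum _ fun k _ =>
      SchwartzMap.integrable_smul_of_memLp (MemLp.matAct hh _) _] at hsum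
  have hneg : ∀ (ψ : 𝓢(R3, ℂ)) x, (-ψ) x = -ψ x := fun _ _ => rfl
  have hR : ((-Complex.I) • ∑ k : Fin 3, ∂_{(EuclideanSpace.single k 1 : R3)}
        (((MemLp.matAct hh (diracAlpha k)).toLp _ : Lp Spinor 2 (volume : Measure R3)) :
          𝓢'(R3, Spinor))) φ = Complex.I • ∑ k : Fin 3,
        ∫ x, (∂_{(EuclideanSpace.single k 1 : R3)} φ) x • matAct (diracAlpha k) (h x) := by
    simp only [Fin.sum_univ_three, _root_.smul_apply, _root_.add_apply,
      TemperedDistribution.lineDerivOp_apply_apply, hLU, hneg]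
    simp only [neg_smul, integral_neg, smul_add, smul_neg, neg_neg]
  rw [hR, TemperedDistribution.laplacian_apply_apply, hLU,
    eq_neg_of_add_eq_zero_right hsum, smul_neg, smul_smul, Complex.I_mul_I]
  simp

open TemperedDistribution in
/-- Square integrable weak solutions with square integrable source belong to `H¹`. -/
theorem IsWeakDirac.memH1 {u h : R3 → Spinor} (hw : IsWeakDirac u h)
    (hu : MemLp u 2 volume) (hh : MemLp h 2 volume) : MemH1 u := by
  refine ⟨hu, ?_⟩
  set U := ((hu.toLp u : Lp Spinor 2 (volume : Measure R3)) : 𝓢'(R3, Spinor)) with hU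
  have hL2 : ∀ f : Lp Spinor 2 (volume : Measure R3), MemSobolev 0 2 (f : 𝓢'(R3, Spinor)) :=
    fun f => memSobolev_zero_iff.2 ⟨f, rfl⟩
  -- In `u - (2π)⁻² Δ u` the first term is in `L²` and the second consists of first derivatives of
  -- `L²` functions, so the sum has order `-1`. Inverting the order-two Bessel potential raises this
  -- to `1`.
  have h1 : MemSobolev (-1) 2 (besselPotential R3 Spinor 2 U) := by
    rw [besselPotential_two_eq, hw.laplacian_eq hu hh, Fin.sum_univ_three]
    refine ((hL2 _).mono (by norm_num)).sub ?_
    have hd : ∀ (f : Lp Spinor 2 (volume : Measure R3)) (m : R3),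
        MemSobolev (-1) 2 (LineDeriv.lineDerivOp m (f : 𝓢'(R3, Spinor))) := fun f m => by
      simpa using (hL2 f).lineDerivOp (m := m)
    exact ((((hd _ _).add (hd _ _)).add (hd _ _)).smul _).smul _
  have h2 := memSobolev_besselPotential_iff.1 h1
  norm_num at h2
  exact h2

/-! ### Decay and regularity of zero energy solutions -/

theorem aestronglyMeasurable_matAct {Q : R3 → Matrix (Fin 4) (Fin 4) ℂ}
    (hQ : ∀ j k, AEStronglyMeasurable (fun x => Q x j k) volume) {f : R3 → Spinor}
    (hf : AEStronglyMeasurable f volume) :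
    AEStronglyMeasurable (fun x => matAct (Q x) (f x)) volume := by
  refine (PiLp.continuous_toLp 2 _).comp_aestronglyMeasurable
    (g := fun v : Fin 4 → ℂ => (WithLp.toLp 2 v : Spinor)) ?_
  refine AEMeasurable.aestronglyMeasurable (aemeasurable_pi_lambda _ fun j => ?_)
  have h : AEStronglyMeasurable (fun x => ∑ k, Q x j k * f x k) volume :=
    Finset.aestronglyMeasurable_fun_sum _ fun k _ => (hQ j k).mul
      ((EuclideanSpace.proj (𝕜 := ℂ) k).continuous.comp_aestronglyMeasurable hf)
  exact h.aemeasurable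

theorem MemWeightedL2.matAct_of_decay {Q : R3 → Matrix (Fin 4) (Fin 4) ℂ}
    (hQ : ∀ j k, AEStronglyMeasurable (fun x => Q x j k) volume) {C ρ : ℝ} (hC : 0 < C)
    (hQdecay : ∀ x j k, ‖Q x j k‖ ≤ C * japaneseBracket x ^ (-ρ)) {s t : ℝ} (hst : t ≤ s + ρ)
    {f : R3 → Spinor} (hf : MemWeightedL2 s f) :
    MemWeightedL2 t (fun x => _root_.matAct (Q x) (f x)) := by
  refine hf.of_le (c := 8 * C) (aestronglyMeasurable_matAct hQ hf.aestronglyMeasurable) fun x => ?_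
  have hj := japaneseBracket_rpow_pos x (-ρ)
  refine (norm_matAct_le (by positivity) (hQdecay x) (f x)).trans ?_
  rw [← mul_assoc]
  have := japaneseBracket_rpow_mono x (show -ρ ≤ s - t by linarith)
  gcongr

/-- Multiplying a weak solution by a power of the Japanese bracket. -/
theorem IsWeakDirac.weighted {f g : R3 → Spinor} (h : IsWeakDirac f g) (μ : ℝ) :
    IsWeakDirac (weighted μ f) (fun x => weighted μ g x + ∑ j : Fin 3,
      (Complex.I * fderiv ℝ (fun x => japaneseBracket x ^ μ) x (EuclideanSpace.single j 1)) •
        matAct (diracAlpha j) (f x)) := by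
  intro φ hφ hφs
  set w : R3 → ℝ := fun x => japaneseBracket x ^ μ with hw
  have hwc : ContDiff ℝ ∞ w := contDiff_japaneseBracket_rpow μ
  -- Moving the weight onto the test function; the derivative falling on the weight produces the
  -- commutator term in the source.
  have h1 := h (fun x => φ x * (w x : ℂ)) (hφ.mul (Complex.ofRealCLM.contDiff.comp hwc))
    hφs.mul_right
  rw [← h1]
  refine integral_congr_ae (.of_forall fun x => ?_)
  have hd : ∀ v, fderiv ℝ (fun x => φ x * (w x : ℂ)) x v =
      φ x * fderiv ℝ w x v + (w x : ℂ) * fderiv ℝ φ x v := fun v => by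
    have h2 : HasFDerivAt (fun x => ((w x : ℝ) : ℂ)) (Complex.ofRealCLM.comp (fderiv ℝ w x)) x :=
      (Complex.ofRealCLM.hasFDerivAt (x := w x)).comp x
        ((hwc.differentiable (by simp)) x).hasFDerivAt
    have h3 : fderiv ℝ (fun x => φ x * (w x : ℂ)) x = _ :=
      (((hφ.differentiable (by simp)) x).hasFDerivAt.mul h2).fderiv
    rw [h3]
    simp
  have hsm : ∀ v : R3 → Spinor, _root_.weighted μ v x = ((w x : ℝ) : ℂ) • v x := fun v =>
    (Complex.coe_smul _ _).symm
  have hA : ∀ j, matAct (diracAlpha j) (((w x : ℝ) : ℂ) • f x) =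
      ((w x : ℝ) : ℂ) • matAct (diracAlpha j) (f x) := fun j => (matCLM _).map_smul _ _
  simp only [hd, hsm, hA, smul_add, Finset.smul_sum, smul_smul]
  rw [add_comm (((φ x) * ((w x : ℝ) : ℂ)) • g x), ← add_assoc, ← Finset.sum_add_distrib]
  congr 1
  refine Finset.sum_congr rfl fun j _ => ?_
  rw [← add_smul]
  congr 1
  ring

/-- A bootstrap with gain `ρ - 1` per round: `Q` raises the exponent by `ρ`, and inverting the Dirac
operator lowers it by one. The ceiling `1/2` is the upper limit `s < 3/2` of the Riesz potential
estimate, shifted by one. -/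
theorem SolvesDirac.memWeightedL2 {Q : R3 → Matrix (Fin 4) (Fin 4) ℂ} {f : R3 → Spinor} (hsol : SolvesDirac Q f)
    (hQmeas : ∀ j k, AEStronglyMeasurable (fun x => Q x j k) volume) {C ρ : ℝ} (hC : 0 < C)
    (hρ : 1 < ρ) (hQdecay : ∀ x j k, ‖Q x j k‖ ≤ C * japaneseBracket x ^ (-ρ))
    (hf : MemWeightedL2 (-3 / 2) f) {τ : ℝ} (hτ : τ < 1 / 2) :
    MemWeightedL2 τ f := by
  have key : ∀ n : ℕ, ∀ τ : ℝ, τ < 1 / 2 → τ ≤ -3 / 2 + n * (ρ - 1) → MemWeightedL2 τ f := by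
    intro n
    induction n with
    | zero =>
      intro τ _ h
      exact hf.mono (by simpa using h)
    | succ n ih =>
      intro τ hτ h
      -- Beyond this trivial case `s = τ + 1` exceeds `-1/2`, as the Riesz potential estimate
      -- demands.
      rcases le_or_gt τ (-3 / 2) with hc | hc
      · exact hf.mono hc
      have h1 := ih (τ - (ρ - 1)) (by linarith) (by push_cast at h; linarith)
      have h2 := MemWeightedL2.matAct_of_decay hQmeas hC hQdecay
        (show τ + 1 ≤ τ - (ρ - 1) + ρ by linarith) h1
      have h3 := IsWeakDirac.memWeightedL2 (s := τ + 1) hsol hf (by linarith) (by linarith) h2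
      simpa using h3
  obtain ⟨n, hn⟩ := exists_nat_gt ((τ + 3 / 2) / (ρ - 1))
  rw [div_lt_iff₀ (by linarith)] at hn
  exact key n τ hτ (by linarith)

/-- Both parts of the weighted source are square integrable: `Q` decays, and `|∇⟨x⟩^μ| ≤ |μ|
⟨x⟩^(μ-1)`, so the commutator is dominated by `⟨x⟩^μ |f|`. -/
theorem SolvesDirac.memH1_weighted {Q : R3 → Matrix (Fin 4) (Fin 4) ℂ} {f : R3 → Spinor} (hsol : SolvesDirac Q f)
    (hQmeas : ∀ j k, AEStronglyMeasurable (fun x => Q x j k) volume) {C ρ : ℝ} (hC : 0 < C)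
    (hρ : 1 < ρ) (hQdecay : ∀ x j k, ‖Q x j k‖ ≤ C * japaneseBracket x ^ (-ρ))
    (hf : MemWeightedL2 (-3 / 2) f) {μ : ℝ} (hμ : μ < 1 / 2) :
    MemH1 (weighted μ f) := by
  have h1 : MemWeightedL2 μ f := hsol.memWeightedL2 hQmeas hC hρ hQdecay hf hμ
  have h2 : MemWeightedL2 μ (fun x => matAct (Q x) (f x)) :=
    h1.matAct_of_decay hQmeas hC hQdecay (by linarith)
  refine IsWeakDirac.memH1 (IsWeakDirac.weighted hsol μ) h1 (MemLp.add h2 ?_)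
  refine memLp_finsetSum _ fun j _ => ?_
  have hc : Continuous fun x => fderiv ℝ (fun x => japaneseBracket x ^ μ) x
      (EuclideanSpace.single j 1) :=
    ((contDiff_japaneseBracket_rpow μ).continuous_fderiv (by simp)).clm_apply continuous_const
  have hm : AEStronglyMeasurable (fun x => (Complex.I * ((fderiv ℝ (fun x => japaneseBracket x ^ μ) x
      (EuclideanSpace.single j 1) : ℝ) : ℂ)) • matAct (diracAlpha j) (f x)) volume :=
    (continuous_const.mul (Complex.continuous_ofReal.comp hc)).aestronglyMeasurable.smul
      (h1.matAct _).aestronglyMeasurable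
  have h3 := h1.of_le (t := 0) (c := |μ| * 8) hm fun x => by
    rw [norm_smul, norm_mul, Complex.norm_I, one_mul, Complex.norm_real]
    have h4 : ‖fderiv ℝ (fun x => japaneseBracket x ^ μ) x (EuclideanSpace.single j 1)‖ ≤
        |μ| * japaneseBracket x ^ μ := by
      have h5 := (fderiv ℝ (fun x => japaneseBracket x ^ μ) x).le_opNorm
        (EuclideanSpace.single j 1)
      simp only [PiLp.norm_single, norm_one, mul_one] at h5
      refine h5.trans ((norm_fderiv_japaneseBracket_rpow_le μ x).trans ?_)
      exact mul_le_mul_of_nonneg_left (japaneseBracket_rpow_mono x (by linarith)) (abs_nonneg _)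
    calc _ ≤ (|μ| * japaneseBracket x ^ μ) * (8 * ‖f x‖) :=
          mul_le_mul h4 (norm_diracAlpha_le j _) (norm_nonneg _)
            (mul_nonneg (abs_nonneg _) (japaneseBracket_rpow_pos x μ).le)
      _ = |μ| * 8 * japaneseBracket x ^ (μ - 0) * ‖f x‖ := by
          rw [sub_zero]
          ring
  rw [MemWeightedL2, weighted_zero] at h3
  exact h3

theorem SolvesDirac.isZeroMode {Q : R3 → Matrix (Fin 4) (Fin 4) ℂ} {f : R3 → Spinor} (hsol : SolvesDirac Q f)
    (hQmeas : ∀ j k, AEStronglyMeasurable (fun x => Q x j k) volume) {C ρ : ℝ} (hC : 0 < C)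
    (hρ : 1 < ρ) (hQdecay : ∀ x j k, ‖Q x j k‖ ≤ C * japaneseBracket x ^ (-ρ))
    (hf : MemWeightedL2 (-3 / 2) f) :
    IsZeroMode Q f := by
  have h1 : MemH1 f := by
    have := hsol.memH1_weighted hQmeas hC hρ hQdecay hf (μ := 0) (by norm_num)
    rwa [weighted_zero] at this
  exact ⟨h1.1, h1, hsol⟩

end

/-! ### The main theorem -/

theorem theorem1p1 (Q : R3 → Matrix (Fin 4) (Fin 4) ℂ)
    (hQmeas : ∀ j k, AEStronglyMeasurable (fun x => Q x j k) volume)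
    (hQherm : ∀ x, (Q x).IsHermitian)
    (C ρ : ℝ) (hC : 0 < C) (hρ : 1 < ρ)
    (hQdecay : ∀ x j k, ‖Q x j k‖ ≤ C * japaneseBracket x ^ (-ρ)) :
    (∀ f : R3 → Spinor, MemWeightedL2 (-3 / 2) f → SolvesDirac Q f →
      (∀ μ : ℝ, μ < 1 / 2 → MemH1 (weighted μ f)) ∧ IsZeroMode Q f) ∧
    ¬ HasZeroResonance Q := by
  refine ⟨fun f hf hsol => ⟨fun μ hμ => hsol.memH1_weighted hQmeas hC hρ hQdecay hf hμ,
    hsol.isZeroMode hQmeas hC hρ hQdecay hf⟩, ?_⟩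
  rintro ⟨f, hf, hsol, hnot⟩
  exact hnot (hsol.isZeroMode hQmeas hC hρ hQdecay hf).1
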